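/- Let $n\ge 2$ and let $q\in\mathbb{C}\setminus\{0\}$ be not a root of unity; fix the principal branch of $q^x=e^{x\log q}$ and put $1(q)=\{x\in\mathbb{C}: q^x=1\}$, $[x]_q=\frac{q^x-q^{-x}}{q-q^{-1}}$. Let $U_q=U_q(\mathfrak{gl}_n)$ be the unital associative $\mathbb{C}$-algebra generated by $e_i,f_i$ ($1\le i\le n-1$) and $q^h$ ($h\in\mathfrak{h}=\bigoplus_{k=1}^n\mathbb{C}\epsilon_k$) with relations, where $\alpha_i=\epsilon_i-\epsilon_{i+1}$ and $\langle h,\alpha_i\rangle=h_i-h_{i+1}$: $q^0=1$, $q^hq^{h'}=q^{h+h'}$, $q^he_iq^{-h}=q^{\langle h,\alpha_i\rangle}e_i$, $q^hf_iq^{-h}=q^{-\langle h,\alpha_i\rangle}f_i$, $e_if_j-f_je_i=\delta_{ij}\frac{q^{\alpha_i}-q^{-\alpha_i}}{q-q^{-1}}$, $x_i^2x_j-(q+q^{-1})x_ix_jx_i+x_jx_i^2=0$ for $|i-j|=1$ and $x_ix_j=x_jx_i$ for $|i-j|>1$ (for $x=e$ and $x=f$). Let $\mathfrak{V}=\{(i,j):1\le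 j\le i\le n\}$. A tableau $T(L)$ is an array $L=(l_{ij})_{(i,j)\in\mathfrak{V}}$ of complex numbers, and $\delta^{kj}$ is the array with entry $1$ at $(k,j)$ and $0$ elsewhere. Let $\mathcal{R}$ be the set of the formal relations $(i,j)\ge(i-1,j')$ and $(i-1,j')>(i,j)$ for $2\le i\le n$, and $(n,i)\ge(n,j)$ for $i\ne j$. For $\mathcal{C}\subseteq\mathcal{R}$ let $\mathfrak{V}(\mathcal{C})$ be the set of positions occurring in $\mathcal{C}$; $\mathcal{C}_1,\mathcal{C}_2$ are disconnected if $\mathfrak{V}(\mathcal{C}_1)\cap\mathfrak{V}(\mathcal{C}_2)=\emptyset$, and $\mathcal{C}$ is indecomposable if it is not the union of two nonempty disconnected subsets. Write $v\succeq_{\mathcal{C}}w$ if there is a chain of one or more relations of $\mathcal{C}$ from $v$ down to $w$, and $v\succ_{\mathcal{C}}w$ if there is such a chain containing a strict relation. An indecomposable set $\mathcal{C}\subseteq\mathcal{R}$ is admissible if (i) $(k,i)\succ_{\mathcal{C}}(k,j)$ only if $i<j$; (ii) $(n,i)\succeq_{\mathcal{C}}(n,j)$ only if $i<j$; (iii)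 $\mathcal{C}$ contains no cross, that is, no subset $\{(k,i)\ge(k-1,t),\,(k-1,s)>(k,j)\}$ with $i<j$ and $s<t$; (iv) for all $(k,i),(k,j)\in\mathfrak{V}(\mathcal{C})$ with $k\le n-1$ and $i<j$, either there are $s,t$ with $\{(k,i)>(k+1,s),\ (k+1,s)\ge(k,j),\ (k,i)\ge(k-1,t),\ (k-1,t)>(k,j)\}\subseteq\mathcal{C}$, or there are $s<t$ with $(k+1,s)\succeq_{\mathcal{C}}(k+1,t)$ and $\{(k,i)>(k+1,s),\ (k+1,t)\ge(k,j)\}\subseteq\mathcal{C}$. A tableau $T(L)$ satisfies $(i,j)\ge(r,s)$ (respectively $(i,j)>(r,s)$) if $l_{ij}-l_{rs}\in\mathbb{Z}_{\ge0}+\frac{1(q)}{2}$ (respectively $\mathbb{Z}_{>0}+\frac{1(q)}{2}$). It satisfies $\mathcal{C}$ if it satisfies all relations of $\mathcal{C}$ and, for $k\le n-1$ and $i\neq j$, $l_{ki}-l_{kj}\in\mathbb{Z}+\frac{1(q)}{2}$ only if $(k,i),(k,j)\in\mathfrak{V}(\mathcal{D})$ for some indecomposable $\mathcal{D}\subseteq\mathcal{C}$.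 Let $\mathcal{B}_{\mathcal{C}}(T(L))$ be the set of tableaux $T(L+z)$ satisfying $\mathcal{C}$, where $z$ is an integral array vanishing in row $n$, and let $V_{\mathcal{C}}(T(L))$ be the complex vector space with basis $\mathcal{B}_{\mathcal{C}}(T(L))$. **Theorem.** Let $\mathcal{C}$ be a union of pairwise disconnected indecomposable admissible sets of relations. Then $\mathcal{C}$ is realizable: for every tableau $T(L)$ satisfying $\mathcal{C}$, the denominators below are nonzero for all $T(R)\in\mathcal{B}_{\mathcal{C}}(T(L))$, and there is a $U_q(\mathfrak{gl}_n)$-module structure on $V_{\mathcal{C}}(T(L))$ such that, for every $T(R)\in\mathcal{B}_{\mathcal{C}}(T(L))$ with entries $r_{ij}$, $$q^{h}\,T(R)=q^{\sum_k h_ka_k}\,T(R)\quad\Big(h=\sum_k h_k\epsilon_k\in\mathfrak{h}\Big),\qquad a_k=\sum_{i=1}^{k}r_{k,i}-\sum_{i=1}^{k-1}r_{k-1,i}+k,$$ (in particular $q^{\epsilon_k}T(R)=q^{a_k}T(R)$) and, for $1\le k\le n-1$, $$e_k\,T(R)=-\sum_{j=1}^{k}\frac{\prod_{i}[r_{k+1,i}-r_{k,j}]_q}{\prod_{i\ne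 j}[r_{k,i}-r_{k,j}]_q}\,T(R+\delta^{kj}),\qquad f_k\,T(R)=\sum_{j=1}^{k}\frac{\prod_{i}[r_{k-1,i}-r_{k,j}]_q}{\prod_{i\ne j}[r_{k,i}-r_{k,j}]_q}\,T(R-\delta^{kj}),$$ where a tableau that is not in $\mathcal{B}_{\mathcal{C}}(T(L))$ is read as $0$. -/

import Mathlib

noncomputable section

namespace QuantumGT

/-! ### Quantum numbers -/

/-- `1(q)`: the set of all complex `x` with `q ^ x = 1`. -/
def oneSet (q : ℂ) : Set ℂ := {x | q ^ x = 1}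

/-- The quantum number `[x]_q = (q^x - q^{-x}) / (q - q^{-1})`. -/
def qnum (q x : ℂ) : ℂ := (q ^ x - q ^ (-x)) / (q - q⁻¹)

/-! ### The quantized enveloping algebra of `gl_n` -/

/-- Generators `e_1, …, e_{n-1}`, `f_1, …, f_{n-1}` (the index `i : Fin (n - 1)` stands for `i + 1`)
and `q^h`, where `h` runs over the Cartan subalgebra `ℂ^n` with basis `ε_1, …, ε_n`. -/
inductive Gen (n : ℕ) : Type
  | e (i : Fin (n - 1))
  | f (i : Fin (n - 1))
  | qpow (h : Fin n → ℂ)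

/-- The simple root `α_i = ε_i - ε_{i+1}`, as an element of the Cartan subalgebra. -/
def simpleRoot (n : ℕ) (i : Fin (n - 1)) : Fin n → ℂ :=
  Pi.single ⟨i.1, by omega⟩ 1 - Pi.single ⟨i.1 + 1, by omega⟩ 1

/-- The pairing `⟨h, α_i⟩ = h_i - h_{i+1}`. -/
def rootPairing (n : ℕ) (h : Fin n → ℂ) (i : Fin (n - 1)) : ℂ :=
  h ⟨i.1, by omega⟩ - h ⟨i.1 + 1, by omega⟩

section Relations

variable {n : ℕ}

/-- The generator `e_i` in the free algebra. -/
def E (i : Fin (n - 1)) : FreeAlgebra ℂ (Gen n) := FreeAlgebra.ι ℂ (Gen.e i)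

/-- The generator `f_i` in the free algebra. -/
def F (i : Fin (n - 1)) : FreeAlgebra ℂ (Gen n) := FreeAlgebra.ι ℂ (Gen.f i)

/-- The generator `q^h` in the free algebra. -/
def K (h : Fin n → ℂ) : FreeAlgebra ℂ (Gen n) := FreeAlgebra.ι ℂ (Gen.qpow h)

/-- The defining relations of `U_q(gl_n)`. -/
inductive UqRel (n : ℕ) (q : ℂ) : FreeAlgebra ℂ (Gen n) → FreeAlgebra ℂ (Gen n) → Prop
  | qpow_zero : UqRel n q (K 0) 1
  | qpow_add (h h' : Fin n → ℂ) : UqRel n q (K h * K h') (K (h + h'))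
  | qpow_e (h : Fin n → ℂ) (i : Fin (n - 1)) :
      UqRel n q (K h * E i * K (-h)) (q ^ (rootPairing n h i) • E i)
  | qpow_f (h : Fin n → ℂ) (i : Fin (n - 1)) :
      UqRel n q (K h * F i * K (-h)) (q ^ (-(rootPairing n h i)) • F i)
  | e_f_same (i : Fin (n - 1)) :
      UqRel n q (E i * F i - F i * E i)
        ((q - q⁻¹)⁻¹ • (K (simpleRoot n i) - K (-(simpleRoot n i))))
  | e_f_diff (i j : Fin (n - 1)) (hij : i ≠ j) : UqRel n q (E i * F j - F j * E i) 0
  | serre_e (i j : Fin (n - 1)) (hij : i.1 + 1 = j.1 ∨ j.1 + 1 = i.1) :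
      UqRel n q (E i ^ 2 * E j - (q + q⁻¹) • (E i * E j * E i) + E j * E i ^ 2) 0
  | serre_f (i j : Fin (n - 1)) (hij : i.1 + 1 = j.1 ∨ j.1 + 1 = i.1) :
      UqRel n q (F i ^ 2 * F j - (q + q⁻¹) • (F i * F j * F i) + F j * F i ^ 2) 0
  | comm_e (i j : Fin (n - 1)) (hij : i.1 + 1 < j.1 ∨ j.1 + 1 < i.1) :
      UqRel n q (E i * E j) (E j * E i)
  | comm_f (i j : Fin (n - 1)) (hij : i.1 + 1 < j.1 ∨ j.1 + 1 < i.1) :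
      UqRel n q (F i * F j) (F j * F i)

end Relations

/-- The algebra `U_q(gl_n)`. -/
abbrev Uq (n : ℕ) (q : ℂ) : Type := RingQuot (UqRel n q)

/-- The image of a generator in `U_q(gl_n)`. -/
def Uq.gen (n : ℕ) (q : ℂ) (g : Gen n) : Uq n q :=
  RingQuot.mkAlgHom ℂ (UqRel n q) (FreeAlgebra.ι ℂ g)

/-! ### Tableaux and sets of relations -/

/-- The set `𝔙` of positions `(i, j)`, `1 ≤ j ≤ i ≤ n`, of a tableau of height `n`.
The pair `⟨a, b⟩` stands for the position `(a + 1, b + 1)`. -/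
abbrev Vertex (n : ℕ) : Type := Σ a : Fin n, Fin (a.1 + 1)

/-- The row index `i` (from `1` to `n`) of the position `(i, j)`. -/
def row {n : ℕ} (v : Vertex n) : ℕ := v.1.1 + 1

/-- The column index `j` (from `1` to `i`) of the position `(i, j)`. -/
def col {n : ℕ} (v : Vertex n) : ℕ := v.2.1 + 1

/-- A tableau `T(L)` of height `n`, given by its array of entries `L`. -/
abbrev Tableau (n : ℕ) : Type := Vertex n → ℂ

/-- `T(L + m δ^v)`: the entry at `v` is changed by `m`. -/
def shift {n : ℕ} (L : Tableau n) (v : Vertex n) (m : ℤ) : Tableau n :=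
  L + Pi.single v (m : ℂ)

/-- A formal relation between two positions: `hi > lo` if `strict` is `true`,
and `hi ≥ lo` if `strict` is `false`. -/
structure GTRelation (n : ℕ) : Type where
  hi : Vertex n
  lo : Vertex n
  strict : Bool

/-- The set of relations `(i, j) ≥ (i - 1, j')`. -/
def relGeq (n : ℕ) : Set (GTRelation n) :=
  {r | r.strict = false ∧ row r.hi = row r.lo + 1}

/-- The set of relations `(i - 1, j') > (i, j)`. -/
def relGt (n : ℕ) : Set (GTRelation n) :=
  {r | r.strict = true ∧ row r.hi + 1 = row r.lo}

/-- The set of relations `(n, i) ≥ (n, j)`, `i ≠ j`. -/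
def relTop (n : ℕ) : Set (GTRelation n) :=
  {r | r.strict = false ∧ row r.hi = n ∧ row r.lo = n ∧ r.hi ≠ r.lo}

/-- The set `ℛ` of all relations under consideration. -/
def allRel (n : ℕ) : Set (GTRelation n) := relGeq n ∪ relGt n ∪ relTop n

section Sets

variable {n : ℕ}

/-- The relation `v ≥ w` belongs to `C`. -/
def HasGeq (C : Set (GTRelation n)) (v w : Vertex n) : Prop := GTRelation.mk v w false ∈ C

/-- The relation `v > w` belongs to `C`. -/
def HasGt (C : Set (GTRelation n)) (v w : Vertex n) : Prop := GTRelation.mk v w true ∈ C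

/-- `𝔙(C)`: the positions that occur in some relation of `C`. -/
def verts (C : Set (GTRelation n)) : Set (Vertex n) := {v | ∃ r ∈ C, r.hi = v ∨ r.lo = v}

/-- Two sets of relations are disconnected if they involve no common position. -/
def Disconnected (C₁ C₂ : Set (GTRelation n)) : Prop := Disjoint (verts C₁) (verts C₂)

/-- `C` is not the union of two nonempty disconnected sets. -/
def Indecomposable (C : Set (GTRelation n)) : Prop :=
  ¬ ∃ C₁ C₂ : Set (GTRelation n),
    C₁.Nonempty ∧ C₂.Nonempty ∧ C = C₁ ∪ C₂ ∧ Disconnected C₁ C₂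

/-- One step of a chain of relations of `C`. -/
def Step (C : Set (GTRelation n)) (v w : Vertex n) : Prop := HasGeq C v w ∨ HasGt C v w

/-- `v ⪰_C w`: there is a chain of at least one relation of `C` from `v` down to `w`. -/
def Succeq (C : Set (GTRelation n)) (v w : Vertex n) : Prop := Relation.TransGen (Step C) v w

/-- `v ≻_C w`: there is such a chain in which at least one relation is strict. -/
def Succ (C : Set (GTRelation n)) (v w : Vertex n) : Prop :=
  ∃ a b, Relation.ReflTransGen (Step C) v a ∧ HasGt C a b ∧ Relation.ReflTransGen (Step C) b w

/-- `C` contains a cross `{(k,i) ≥ (k-1,t), (k-1,s) > (k,j)}` with `i < j` and `s < t`. -/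
def HasCross (C : Set (GTRelation n)) : Prop :=
  ∃ ki kt ks kj : Vertex n, row ki = row kj ∧ row kt = row ks ∧ row ki = row kt + 1 ∧
    HasGeq C ki kt ∧ HasGt C ks kj ∧ col ki < col kj ∧ col ks < col kt

/-- The class `𝔉` of indecomposable admissible sets of relations. -/
structure IndecomposableAdmissible (C : Set (GTRelation n)) : Prop where
  subset : C ⊆ allRel n
  indecomposable : Indecomposable C
  /-- `(k, i) ≻_C (k, j)` only if `i < j`. -/
  succ_lt : ∀ v w, row v = row w → Succ C v w → col v < col w
  /-- `(n, i) ⪰_C (n, j)` only if `i < j`. -/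
  top_lt : ∀ v w, row v = n → row w = n → Succeq C v w → col v < col w
  no_cross : ¬ HasCross C
  /-- For `(k, i), (k, j) ∈ 𝔙(C)` with `k ≤ n - 1` and `i < j`, either
  `(k, i) > (k + 1, s) ≥ (k, j)` and `(k, i) ≥ (k - 1, t) > (k, j)` for some `s`, `t`, or
  `(k, i) > (k + 1, s)` and `(k + 1, t) ≥ (k, j)` for some `s < t` with
  `(k + 1, s) ⪰_C (k + 1, t)`. The rows of `s` and `t` are forced by `C ⊆ ℛ`. -/
  pair : ∀ v w, v ∈ verts C → w ∈ verts C → row v = row w → row v < n → col v < col w →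
    (∃ s t, (HasGt C v s ∧ HasGeq C s w) ∧ (HasGeq C v t ∧ HasGt C t w)) ∨
    (∃ s t, col s < col t ∧ Succeq C s t ∧ HasGt C v s ∧ HasGeq C t w)

/-- `T(L)` satisfies a relation: the difference of the two entries is in
`ℤ_{≥ 0} + 1(q)/2`, respectively in `ℤ_{> 0} + 1(q)/2`. -/
def SatisfiesRel (q : ℂ) (L : Tableau n) (r : GTRelation n) : Prop :=
  ∃ m : ℤ, (if r.strict = true then 0 < m else 0 ≤ m) ∧
    ∃ x ∈ oneSet q, L r.hi - L r.lo = (m : ℂ) + x / 2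

/-- `T(L)` satisfies `C`: it satisfies all relations of `C`, and two entries of the same row
`k ≤ n - 1` differ by an element of `ℤ + 1(q)/2` only if their positions belong to the same
indecomposable part of `C`. -/
def Satisfies (q : ℂ) (C : Set (GTRelation n)) (L : Tableau n) : Prop :=
  (∀ r ∈ C, SatisfiesRel q L r) ∧
  ∀ v w : Vertex n, v ≠ w → row v = row w → row v < n →
    (∃ m : ℤ, ∃ x ∈ oneSet q, L v - L w = (m : ℂ) + x / 2) →
    ∃ D ⊆ C, Indecomposable D ∧ v ∈ verts D ∧ w ∈ verts D

/-- `ℬ_C(T(L))`: the tableaux `T(L + z)` satisfying `C`, where `z` is an integral vector that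
vanishes in row `n`. -/
def basisSet (q : ℂ) (C : Set (GTRelation n)) (L : Tableau n) : Set (Tableau n) :=
  {R | Satisfies q C R ∧
    ∃ z : Vertex n → ℤ, (∀ v, row v = n → z v = 0) ∧ R = fun v => L v + (z v : ℂ)}

/-- `V_C(T(L))`: the complex vector space with basis `ℬ_C(T(L))`. -/
abbrev GTSpace (q : ℂ) (C : Set (GTRelation n)) (L : Tableau n) : Type :=
  basisSet q C L →₀ ℂ

open scoped Classical in
/-- The vector `T(R)` of `V_C(T(L))`; it is zero if `T(R)` is not in `ℬ_C(T(L))`. -/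
def tabVec (q : ℂ) (C : Set (GTRelation n)) (L R : Tableau n) : GTSpace q C L :=
  if hR : R ∈ basisSet q C L then Finsupp.single ⟨R, hR⟩ 1 else 0

/-! ### Gelfand–Tsetlin formulas -/

/-- The positions of row `k` (none if `k = 0`). -/
def rowSet (n k : ℕ) : Finset (Vertex n) := Finset.univ.filter fun v => row v = k

/-- `a_k = ∑_i l_{k,i} - ∑_i l_{k-1,i} + k`, where the index `k : Fin n` stands for `k + 1`. -/
def weight (L : Tableau n) (k : Fin n) : ℂ :=
  ∑ v ∈ rowSet n (k.1 + 1), L v - ∑ v ∈ rowSet n k.1, L v + ((k.1 + 1 : ℕ) : ℂ)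

/-- `∏_{i ≠ j} [l_{k,i} - l_{k,j}]_q` for `v = (k, j)`. -/
def denom (q : ℂ) (L : Tableau n) (v : Vertex n) : ℂ :=
  ∏ w ∈ (rowSet n (row v)).erase v, qnum q (L w - L v)

/-- `- ∏_i [l_{k+1,i} - l_{k,j}]_q / ∏_{i ≠ j} [l_{k,i} - l_{k,j}]_q` for `v = (k, j)`. -/
def eCoeff (q : ℂ) (L : Tableau n) (v : Vertex n) : ℂ :=
  -((∏ w ∈ rowSet n (row v + 1), qnum q (L w - L v)) / denom q L v)

/-- `∏_i [l_{k-1,i} - l_{k,j}]_q / ∏_{i ≠ j} [l_{k,i} - l_{k,j}]_q` for `v = (k, j)`. -/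
def fCoeff (q : ℂ) (L : Tableau n) (v : Vertex n) : ℂ :=
  (∏ w ∈ rowSet n (row v - 1), qnum q (L w - L v)) / denom q L v

/-- `C` is realizable: for every tableau `T(L)` satisfying `C`, the denominators of the
Gelfand–Tsetlin formulas do not vanish on `ℬ_C(T(L))`, and these formulas define a
`U_q(gl_n)`-module structure on `V_C(T(L))`. Tableaux outside `ℬ_C(T(L))` are read as zero. -/
def Realizable (q : ℂ) (C : Set (GTRelation n)) : Prop :=
  ∀ L : Tableau n, Satisfies q C L →
    (∀ R ∈ basisSet q C L, ∀ v : Vertex n, row v < n → denom q R v ≠ 0) ∧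
    ∃ ρ : Uq n q →ₐ[ℂ] Module.End ℂ (GTSpace q C L), ∀ R ∈ basisSet q C L,
      (∀ h : Fin n → ℂ, ρ (Uq.gen n q (Gen.qpow h)) (tabVec q C L R) =
        q ^ (∑ k, h k * weight R k) • tabVec q C L R) ∧
      (∀ k : Fin (n - 1), ρ (Uq.gen n q (Gen.e k)) (tabVec q C L R) =
        ∑ v ∈ rowSet n (k.1 + 1), eCoeff q R v • tabVec q C L (shift R v 1)) ∧
      (∀ k : Fin (n - 1), ρ (Uq.gen n q (Gen.f k)) (tabVec q C L R) =
        ∑ v ∈ rowSet n (k.1 + 1), fCoeff q R v • tabVec q C L (shift R v (-1)))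

end Sets

end QuantumGT

end

/-! The Gelfand–Tsetlin formulas define operators on `V_C`, and each defining relation of `U_q` has
to be checked on a basis tableau. Two difficulties arise: tableaux that leave the basis are
discarded, and entries of one row may differ by exactly one modulo `1(q)/2`, where the usual
rational identities degenerate.

Discarding is harmless. If a path of steps leaves the basis and ends inside it, some relation of `C`
fails on the way. A relation `≥` can only break through a step whose numerator vanishes; a relation
`>` can break freely, but can only be restored through such a step. So a product of two or three
operators is the sum over all formal paths (`stepOp_stepOp_tabVec`, `stepOp_stepOp_stepOp_tabVec`),
and the relations become identities between coefficients.

The degenerate gaps are controlled by the last admissibility condition: integrally related entries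
in a row below `n` lie in one component and are interlaced. Hence they never coincide, so the
denominators are nonzero. If they differ by one, two entries of neighbouring rows are pinned
(`Interlaced.squeeze`). This is used twice.

For `[e_k, f_k]`, steps at different positions cancel by `stepCoeff_exchange`. The diagonal part is
a Lagrange interpolation sum with nodes `r` and `r - 1`, for `r` in row `k`. Nodes collide exactly
when two entries differ by one, and the pinned entries then give a double root of the numerator that
removes the colliding pair (`sum_prod_sub_div`, `sum_commutator_coeff`).

For the Serre relations, the contributions of the two orders of `u`, `v` cancel by a rational
identity unless the entries there differ by one. In that case both pinned entries would have to move
along with `u` and `v`, but only one further entry moves; the final tableau is therefore outside the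
basis (`Satisfies.not_gap_one`, `serreCoeff_add`). -/

namespace QuantumGT

/-! ### Interpolation -/

section Interpolation

variable {F ι κ : Type*} [Field F] [DecidableEq ι]

/-- This reads off the leading coefficient of the monic polynomial `∏ (X - a i)` by Lagrange
interpolation at the nodes `N m` and one extra node `0`. The extra node produces the quotient of
products on the right, the leading coefficient the `1`. -/
theorem sum_prod_sub_div_of_injOn (S : Finset ι) (T : Finset κ) (N : ι → F) (a : κ → F)
    (hcard : S.card = T.card) (hN : ∀ i ∈ S, N i ≠ 0) (hinj : Set.InjOn N S) :
    ∑ m ∈ S, (∏ i ∈ T, (a i - N m)) / (N m * ∏ m' ∈ S.erase m, (N m' - N m)) =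
      (∏ i ∈ T, a i) / (∏ m ∈ S, N m) - 1 := by
  classical
  -- `none` carries the extra node `0`; there are then `T.card + 1` nodes for a polynomial of degree
  -- `T.card`.
  set v : Option ι → F := fun o => o.elim 0 N with hv
  set s : Finset (Option ι) := Finset.insertNone S with hs
  set P : Polynomial F := ∏ i ∈ T, (Polynomial.X - Polynomial.C (a i)) with hP
  have hmonic : P.Monic := Polynomial.monic_prod_of_monic _ _ fun i _ => Polynomial.monic_X_sub_C _
  have hdeg : P.natDegree = T.card := by
    rw [hP, Polynomial.natDegree_prod_of_monic _ _ fun i _ => Polynomial.monic_X_sub_C _]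
    simp
  have hcs : s.card = T.card + 1 := by rw [hs, Finset.card_insertNone, hcard]
  have hvs : Set.InjOn v s := by
    rintro (_ | x) hx (_ | y) hy hxy
    · rfl
    · exact absurd hxy.symm (hN y (by simpa [hs] using hy))
    · exact absurd hxy (hN x (by simpa [hs] using hx))
    · rw [hinj (by simpa [hs] using hx) (by simpa [hs] using hy) hxy]
  have key := Lagrange.coeff_eq_sum (s := s) (v := v) hvs (P := P) (by
    rw [Polynomial.degree_eq_natDegree hmonic.ne_zero, hdeg, hcs]; exact_mod_cast Nat.lt_succ_self _)
  have hlead : P.coeff (s.card - 1) = 1 := by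
    rw [hcs, Nat.add_sub_cancel, ← hdeg]; exact hmonic.leadingCoeff
  have heval : ∀ x, P.eval x = (-1) ^ T.card * ∏ i ∈ T, (a i - x) := by
    intro x
    rw [hP, Polynomial.eval_prod, ← Finset.prod_const, ← Finset.prod_mul_distrib]
    exact Finset.prod_congr rfl fun i _ => by simp
  have hnone : s.erase none = S.map Function.Embedding.some := by
    ext (_ | x) <;> simp [hs]
  have hsome : ∀ m ∈ S, ∏ o ∈ s.erase (some m), (v (some m) - v o) =
      N m * ((-1) ^ (T.card - 1) * ∏ m' ∈ S.erase m, (N m' - N m)) := by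
    intro m hm
    have h1 : s.erase (some m) = Finset.insertNone (S.erase m) := by
      ext (_ | x) <;> simp [hs]
    rw [h1, Finset.prod_insertNone, ← hcard, ← Finset.card_erase_of_mem hm, ← Finset.prod_const,
      ← Finset.prod_mul_distrib]
    simp [hv]
  rw [hlead, hs, Finset.sum_insertNone, ← hs, hnone, Finset.prod_map] at key
  have hnodes : ∑ m ∈ S, P.eval (v (some m)) / ∏ o ∈ s.erase (some m), (v (some m) - v o) =
      - ∑ m ∈ S, (∏ i ∈ T, (a i - N m)) / (N m * ∏ m' ∈ S.erase m, (N m' - N m)) := by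
    rw [← Finset.sum_neg_distrib]
    refine Finset.sum_congr rfl fun m hm => ?_
    rw [hsome m hm, heval]
    obtain ⟨c, hc⟩ : ∃ c, T.card = c + 1 :=
      Nat.exists_eq_succ_of_ne_zero (hcard ▸ (Finset.card_pos.2 ⟨m, hm⟩).ne')
    have h2 : ((-1 : F)) ^ c ≠ 0 := pow_ne_zero _ (by simp)
    rw [hc, Nat.add_sub_cancel, pow_succ, mul_left_comm (N m), mul_assoc, mul_div_mul_left _ _ h2]
    simp [hv, neg_div]
  have hzero : P.eval (v none) / ∏ x ∈ S, (v none - v (Function.Embedding.some x)) =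
      (∏ i ∈ T, a i) / ∏ m ∈ S, N m := by
    have h2 : ((-1 : F)) ^ T.card ≠ 0 := pow_ne_zero _ (by simp)
    have h3 : ∏ x ∈ S, (v none - v (Function.Embedding.some x)) =
        (-1) ^ T.card * ∏ m ∈ S, N m := by
      rw [← hcard, ← Finset.prod_const, ← Finset.prod_mul_distrib]
      exact Finset.prod_congr rfl fun i _ => by simp [hv]
    rw [h3, heval, mul_div_mul_left _ _ h2]
    simp [hv]
  rw [hnodes, hzero] at key
  linear_combination key

/-- Interpolation with nodes of multiplicity at most two, every double node being a double root of
the numerator. The terms at double nodes vanish. -/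
theorem sum_prod_sub_div [DecidableEq κ] (S : Finset ι) (T : Finset κ) (N : ι → F) (a : κ → F)
    (hcard : S.card = T.card) (hN : ∀ i ∈ S, N i ≠ 0)
    (htriple : ∀ i ∈ S, ∀ j ∈ S, ∀ k ∈ S, i ≠ j → i ≠ k → j ≠ k → N i = N j → N i ≠ N k)
    (hdouble : ∀ i ∈ S, ∀ j ∈ S, i ≠ j → N i = N j →
      ∃ s ∈ T, ∃ t ∈ T, s ≠ t ∧ a s = N i ∧ a t = N i) :
    ∑ m ∈ S, (∏ i ∈ T, (a i - N m)) / (N m * ∏ m' ∈ S.erase m, (N m' - N m)) =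
      (∏ i ∈ T, a i) / (∏ m ∈ S, N m) - 1 := by
  induction hc : S.card using Nat.strong_induction_on generalizing S T with
  | _ c ih =>
    by_cases hinj : Set.InjOn N S
    · exact sum_prod_sub_div_of_injOn S T N a hcard hN hinj
    · simp only [Set.InjOn, not_forall] at hinj
      obtain ⟨i, hi, j, hj, hNij, hij⟩ := hinj
      have hi : i ∈ S := hi
      have hj : j ∈ S := hj
      obtain ⟨s, hs, t, ht, hst, has, hat⟩ := hdouble i hi j hj hij hNij
      have hj' : j ∈ S.erase i := Finset.mem_erase.2 ⟨Ne.symm hij, hj⟩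
      have ht' : t ∈ T.erase s := Finset.mem_erase.2 ⟨hst.symm, ht⟩
      -- Induction removes the colliding pair of nodes together with two matching roots. Their
      -- factors cancel on both sides, and the terms at `i` and `j` have numerator zero.
      set S' := (S.erase i).erase j with hS'
      set T' := (T.erase s).erase t with hT'
      have hmS : ∀ m ∈ S', m ∈ S ∧ m ≠ i ∧ m ≠ j ∧ N m ≠ N i := by
        intro m hm
        simp only [hS', Finset.mem_erase] at hm
        exact ⟨hm.2.2, hm.2.1, hm.1, fun h =>
          htriple i hi j hj m hm.2.2 hij (Ne.symm hm.2.1) (Ne.symm hm.1) hNij h.symm⟩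
      have hcS : S'.card = S.card - 1 - 1 := by
        rw [hS', Finset.card_erase_of_mem hj', Finset.card_erase_of_mem hi]
      have hcT : T'.card = T.card - 1 - 1 := by
        rw [hT', Finset.card_erase_of_mem ht', Finset.card_erase_of_mem hs]
      have hpos : 0 < S.card := Finset.card_pos.2 ⟨i, hi⟩
      have key := ih S'.card (by omega) S' T' (by omega) (fun m hm => hN m (hmS m hm).1)
        (fun x hx y hy z hz => htriple x (hmS x hx).1 y (hmS y hy).1 z (hmS z hz).1)
        (fun x hx y hy hxy hNxy => by
          obtain ⟨s', hs', t', ht', hst', has', hat'⟩ :=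
            hdouble x (hmS x hx).1 y (hmS y hy).1 hxy hNxy
          have hx' := (hmS x hx).2.2.2
          refine ⟨s', ?_, t', ?_, hst', has', hat'⟩
          · simp only [hT', Finset.mem_erase]
            exact ⟨fun h => hx' (by rw [← has', h, hat]), fun h => hx' (by rw [← has', h, has]), hs'⟩
          · simp only [hT', Finset.mem_erase]
            exact ⟨fun h => hx' (by rw [← hat', h, hat]), fun h => hx' (by rw [← hat', h, has]), ht'⟩)
        rfl
      have hprodT : ∀ g : κ → F, ∏ x ∈ T, g x = g s * (g t * ∏ x ∈ T', g x) := fun g => by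
        rw [Finset.mul_prod_erase _ _ ht', Finset.mul_prod_erase _ _ hs]
      have hprodS : ∀ g : ι → F, ∏ x ∈ S, g x = g i * (g j * ∏ x ∈ S', g x) := fun g => by
        rw [Finset.mul_prod_erase _ _ hj', Finset.mul_prod_erase _ _ hi]
      have hsumS : ∀ g : ι → F, ∑ x ∈ S, g x = g i + (g j + ∑ x ∈ S', g x) := fun g => by
        rw [Finset.add_sum_erase _ _ hj', Finset.add_sum_erase _ _ hi]
      have hNi := hN i hi
      rw [hprodT, hprodS, has, hat, ← hNij, mul_div_mul_left _ _ hNi, mul_div_mul_left _ _ hNi,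
        ← key, hsumS, Finset.prod_eq_zero hs (by rw [has, sub_self]),
        Finset.prod_eq_zero hs (by rw [has, hNij, sub_self])]
      simp only [zero_div, zero_add]
      refine Finset.sum_congr rfl fun m hm => ?_
      obtain ⟨hm1, hm2, hm3, hm4⟩ := hmS m hm
      have hi'' : i ∈ S.erase m := Finset.mem_erase.2 ⟨Ne.symm hm2, hi⟩
      have hj'' : j ∈ (S.erase m).erase i :=
        Finset.mem_erase.2 ⟨Ne.symm hij, Finset.mem_erase.2 ⟨Ne.symm hm3, hj⟩⟩
      have hperm : ((S.erase m).erase i).erase j = S'.erase m := by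
        ext x; simp only [hS', Finset.mem_erase]; tauto
      have hne : N i - N m ≠ 0 := sub_ne_zero.2 (Ne.symm hm4)
      rw [hprodT, ← Finset.mul_prod_erase _ _ hi'', ← Finset.mul_prod_erase _ _ hj'', hperm, has,
        hat, ← hNij, mul_left_comm (N m), mul_div_mul_left _ _ hne, mul_left_comm (N m),
        mul_div_mul_left _ _ hne]

end Interpolation

/-! ### Quantum numbers -/

section QuantumNumbers

variable {q : ℂ}

theorem sub_inv_ne_zero (hq0 : q ≠ 0) (hq : ∀ m : ℕ, 0 < m → q ^ m ≠ 1) : q - q⁻¹ ≠ 0 := by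
  intro h
  apply hq 2 two_pos
  field_simp at h
  linear_combination h

theorem cpow_ne_zero (hq0 : q ≠ 0) (x : ℂ) : q ^ x ≠ 0 := by
  simp [Complex.cpow_eq_zero_iff, hq0]

theorem cpow_two_mul (hq0 : q ≠ 0) (x : ℂ) : q ^ (2 * x) = q ^ x * q ^ x := by
  rw [two_mul, Complex.cpow_add _ _ hq0]

/-- In the variables `q ^ (2 * x)` a quantum number becomes a plain difference times a monomial,
which is what lets ordinary interpolation apply. -/
theorem qnum_eq (hq0 : q ≠ 0) (x y : ℂ) :
    qnum q (x - y) =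
      (q ^ (2 * x) - q ^ (2 * y)) * ((q ^ x)⁻¹ * (q ^ y)⁻¹ * (q - q⁻¹)⁻¹) := by
  have hx : q ^ x ≠ 0 := cpow_ne_zero hq0 _
  have hy : q ^ y ≠ 0 := cpow_ne_zero hq0 _
  rw [qnum, neg_sub, Complex.cpow_sub _ _ hq0, Complex.cpow_sub _ _ hq0, cpow_two_mul hq0,
    cpow_two_mul hq0, div_eq_mul_inv _ (q - q⁻¹)]
  field_simp

theorem qnum_neg (x : ℂ) : qnum q (-x) = -qnum q x := by
  rw [qnum, qnum, neg_neg, ← neg_div, neg_sub]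

theorem qnum_one (hq0 : q ≠ 0) (hq : ∀ m : ℕ, 0 < m → q ^ m ≠ 1) : qnum q 1 = 1 := by
  rw [qnum, Complex.cpow_neg, Complex.cpow_one, div_self (sub_inv_ne_zero hq0 hq)]

/-- `x` is congruent to the integer `m` modulo `1(q)/2`. -/
def Gap (q x : ℂ) (m : ℤ) : Prop := q ^ (2 * x) = q ^ (2 * (m : ℂ))

theorem gap_iff (hq0 : q ≠ 0) (x : ℂ) (m : ℤ) :
    Gap q x m ↔ ∃ y ∈ oneSet q, x = (m : ℂ) + y / 2 := by
  have hm : q ^ (2 * (m : ℂ)) ≠ 0 := cpow_ne_zero hq0 _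
  constructor
  · intro h
    refine ⟨2 * x - 2 * m, ?_, by ring⟩
    rw [oneSet, Set.mem_ofPred_eq, Complex.cpow_sub _ _ hq0, h, div_self hm]
  · rintro ⟨y, hy, rfl⟩
    have hy : q ^ y = 1 := hy
    rw [Gap, mul_add, Complex.cpow_add _ _ hq0, show 2 * (y / 2) = y by ring, hy, mul_one]

theorem Gap.add (hq0 : q ≠ 0) {x y : ℂ} {m k : ℤ} (hx : Gap q x m) (hy : Gap q y k) :
    Gap q (x + y) (m + k) := by
  unfold Gap at *
  rw [mul_add, Complex.cpow_add _ _ hq0, hx, hy, ← Complex.cpow_add _ _ hq0]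
  push_cast
  ring_nf

theorem Gap.neg {x : ℂ} {m : ℤ} (hx : Gap q x m) : Gap q (-x) (-m) := by
  unfold Gap at *
  push_cast
  rw [mul_neg, mul_neg, Complex.cpow_neg, Complex.cpow_neg, hx]

theorem gap_intCast (m : ℤ) : Gap q m m := rfl

theorem gap_add_intCast_iff (hq0 : q ≠ 0) {x : ℂ} {m k : ℤ} :
    Gap q (x + k) m ↔ Gap q x (m - k) := by
  constructor
  · intro h
    have := h.add hq0 (gap_intCast k).neg
    rwa [add_neg_cancel_right, ← sub_eq_add_neg] at this
  · intro h
    have := h.add hq0 (gap_intCast (q := q) k)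
    rwa [sub_add_cancel] at this

/-- Powers of `q` with distinct integer exponents are distinct, so the integer part of a difference
is well defined and chains of relations reduce to integer inequalities. -/
theorem Gap.unique (hq0 : q ≠ 0) (hq : ∀ m : ℕ, 0 < m → q ^ m ≠ 1) {x : ℂ} {m k : ℤ}
    (hm : Gap q x m) (hk : Gap q x k) : m = k := by
  have h : q ^ (2 * m) = q ^ (2 * k) := by
    have := hm.symm.trans hk
    exact_mod_cast this
  by_contra hne
  have hinj : ∀ a b : ℤ, a < b → q ^ a ≠ q ^ b := by
    intro a b hab he
    have h1 : q ^ (b - a) = 1 := by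
      rw [zpow_sub₀ hq0, he, div_self (zpow_ne_zero _ hq0)]
    have h2 : ((b - a).toNat : ℤ) = b - a := Int.toNat_of_nonneg (by omega)
    rw [← h2, zpow_natCast] at h1
    exact hq _ (by omega) h1
  rcases lt_or_gt_of_ne hne with h' | h'
  · exact hinj _ _ (by omega) h
  · exact hinj _ _ (by omega) h.symm

theorem qnum_eq_zero_iff (hq0 : q ≠ 0) (hq : ∀ m : ℕ, 0 < m → q ^ m ≠ 1) (x : ℂ) :
    qnum q x = 0 ↔ Gap q x 0 := by
  have h := qnum_eq hq0 x 0
  have hx : q ^ x ≠ 0 := cpow_ne_zero hq0 _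
  rw [sub_zero] at h
  rw [h, Gap]
  simp [hx, sub_inv_ne_zero hq0 hq, sub_eq_zero]

theorem cpow_two_mul_eq_iff (hq0 : q ≠ 0) (x y : ℂ) :
    q ^ (2 * x) = q ^ (2 * y) ↔ Gap q (x - y) 0 := by
  have hy : q ^ (2 * y) ≠ 0 := cpow_ne_zero hq0 _
  rw [Gap, mul_sub, Complex.cpow_sub _ _ hq0, div_eq_iff hy]
  simp

theorem cpow_sum {ι : Type*} (hq0 : q ≠ 0) (S : Finset ι) (z : ι → ℂ) :
    q ^ (∑ i ∈ S, z i) = ∏ i ∈ S, q ^ z i := by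
  classical
  induction S using Finset.induction_on with
  | empty => simp
  | insert i S hi ih => rw [Finset.sum_insert hi, Finset.prod_insert hi, Complex.cpow_add _ _ hq0, ih]

/-- The interpolation identity at the nodes `q ^ (2 * z i)`. Since numerator and full node set have
the same size, the monomial factors of all terms combine to one common factor, and the difference on
the right becomes a single quantum number. -/
theorem sum_prod_qnum_div {ι κ : Type*} [DecidableEq ι] [DecidableEq κ] (hq0 : q ≠ 0)
    (hq : ∀ m : ℕ, 0 < m → q ^ m ≠ 1) (S : Finset ι) (T : Finset κ) (z : ι → ℂ) (a : κ → ℂ)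
    (hcard : S.card = T.card)
    (htriple : ∀ i ∈ S, ∀ j ∈ S, ∀ k ∈ S, i ≠ j → i ≠ k → j ≠ k → Gap q (z i - z j) 0 →
      ¬ Gap q (z i - z k) 0)
    (hdouble : ∀ i ∈ S, ∀ j ∈ S, i ≠ j → Gap q (z i - z j) 0 →
      ∃ s ∈ T, ∃ t ∈ T, s ≠ t ∧ Gap q (a s - z i) 0 ∧ Gap q (a t - z i) 0) :
    ∑ m ∈ S, (∏ i ∈ T, qnum q (a i - z m)) / ∏ m' ∈ S.erase m, qnum q (z m' - z m) =
      qnum q (∑ i ∈ T, a i - ∑ m ∈ S, z m) := by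
  have hne : ∀ x : ℂ, q ^ x ≠ 0 := cpow_ne_zero hq0
  have hc := sub_inv_ne_zero hq0 hq
  simp only [← cpow_two_mul_eq_iff hq0] at htriple hdouble
  have key := sum_prod_sub_div S T (fun i => q ^ (2 * z i)) (fun i => q ^ (2 * a i)) hcard
    (fun i _ => hne _) htriple hdouble
  have h2 : ∏ i ∈ S, q ^ (2 * z i) = q ^ (∑ i ∈ S, z i) * q ^ (∑ i ∈ S, z i) := by
    simp only [cpow_two_mul hq0, Finset.prod_mul_distrib, cpow_sum hq0]
  have h3 : ∏ i ∈ T, q ^ (2 * a i) = q ^ (∑ i ∈ T, a i) * q ^ (∑ i ∈ T, a i) := by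
    simp only [cpow_two_mul hq0, Finset.prod_mul_distrib, cpow_sum hq0]
  rw [h2, h3] at key
  set A := ∑ i ∈ T, a i with hA
  set Z := ∑ i ∈ S, z i with hZ
  have hterm : ∀ m ∈ S,
      (∏ i ∈ T, qnum q (a i - z m)) / ∏ m' ∈ S.erase m, qnum q (z m' - z m) =
      (q ^ Z * (q ^ A)⁻¹ * (q - q⁻¹)⁻¹) * ((∏ i ∈ T, (q ^ (2 * a i) - q ^ (2 * z m))) /
        (q ^ (2 * z m) * ∏ m' ∈ S.erase m, (q ^ (2 * z m') - q ^ (2 * z m)))) := by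
    intro m hm
    have hz : q ^ Z = q ^ z m * ∏ m' ∈ S.erase m, q ^ z m' := by
      rw [hZ, cpow_sum hq0, Finset.mul_prod_erase S (fun i => q ^ z i) hm]
    have hpos : 0 < T.card := hcard ▸ Finset.card_pos.2 ⟨m, hm⟩
    obtain ⟨c, hc'⟩ : ∃ c, T.card = c + 1 := Nat.exists_eq_succ_of_ne_zero hpos.ne'
    have hce : (S.erase m).card = c := by rw [Finset.card_erase_of_mem hm]; omega
    have hP : ∏ m' ∈ S.erase m, q ^ z m' ≠ 0 := Finset.prod_ne_zero_iff.2 fun _ _ => hne _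
    simp only [qnum_eq hq0, Finset.prod_mul_distrib, Finset.prod_const, Finset.prod_inv_distrib]
    rw [← cpow_sum hq0 T, ← hA, hz, hc', hce, pow_succ, pow_succ, cpow_two_mul hq0 (z m)]
    have h1 := hne (z m)
    have h4 := hne A
    have h5 : (q - q⁻¹)⁻¹ ≠ 0 := inv_ne_zero hc
    generalize (q - q⁻¹)⁻¹ = d at h5 ⊢
    generalize ∏ m' ∈ S.erase m, q ^ z m' = p at hP ⊢
    generalize q ^ z m = u at h1 ⊢
    generalize q ^ A = w at h4 ⊢
    simp only [div_eq_mul_inv, mul_inv, inv_inv]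
    field_simp
  rw [Finset.sum_congr rfl hterm, ← Finset.mul_sum, key, qnum, neg_sub, Complex.cpow_sub _ _ hq0,
    Complex.cpow_sub _ _ hq0]
  have h1 := hne A
  have h4 := hne Z
  field_simp

end QuantumNumbers

variable {n : ℕ} {q : ℂ} {C : Set (GTRelation n)} {L R : Tableau n}

/-! ### Relations satisfied by tableaux -/

theorem vertex_ext {v w : Vertex n} (hrow : row v = row w) (hcol : col v = col w) : v = w := by
  obtain ⟨⟨a, ha⟩, ⟨b, hb⟩⟩ := v
  obtain ⟨⟨a', ha'⟩, ⟨b', hb'⟩⟩ := w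
  simp only [row, col, add_left_inj] at hrow hcol
  subst hrow
  subst hcol
  rfl

theorem one_le_row (v : Vertex n) : 1 ≤ row v := Nat.le_add_left _ _

theorem mem_rowSet {k : ℕ} {v : Vertex n} : v ∈ rowSet n k ↔ row v = k := by
  simp [rowSet]

theorem satisfiesRel_iff (hq0 : q ≠ 0) (L : Tableau n) (r : GTRelation n) :
    SatisfiesRel q L r ↔
      ∃ m : ℤ, (if r.strict = true then 0 < m else 0 ≤ m) ∧ Gap q (L r.hi - L r.lo) m := by
  simp only [SatisfiesRel, gap_iff hq0]

theorem HasGeq.gap (hq0 : q ≠ 0) (hL : ∀ r ∈ C, SatisfiesRel q L r) {v w : Vertex n}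
    (h : HasGeq C v w) : ∃ m : ℤ, 0 ≤ m ∧ Gap q (L v - L w) m := by
  simpa using (satisfiesRel_iff hq0 L _).1 (hL _ h)

theorem HasGt.gap (hq0 : q ≠ 0) (hL : ∀ r ∈ C, SatisfiesRel q L r) {v w : Vertex n}
    (h : HasGt C v w) : ∃ m : ℤ, 0 < m ∧ Gap q (L v - L w) m := by
  simpa using (satisfiesRel_iff hq0 L _).1 (hL _ h)

theorem Gap.trans (hq0 : q ≠ 0) {x y z : ℂ} {m k : ℤ} (h₁ : Gap q (x - y) m)
    (h₂ : Gap q (y - z) k) : Gap q (x - z) (m + k) := by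
  simpa using h₁.add hq0 h₂

theorem Gap.symm {x y : ℂ} {m : ℤ} (h : Gap q (x - y) m) : Gap q (y - x) (-m) := by
  simpa using h.neg

theorem Succeq.gap (hq0 : q ≠ 0) (hL : ∀ r ∈ C, SatisfiesRel q L r) {v w : Vertex n}
    (h : Succeq C v w) : ∃ m : ℤ, 0 ≤ m ∧ Gap q (L v - L w) m := by
  have hstep : ∀ {v w}, Step C v w → ∃ m : ℤ, 0 ≤ m ∧ Gap q (L v - L w) m := by
    rintro v w (h | h)
    · exact h.gap hq0 hL
    · obtain ⟨m, hm, hg⟩ := h.gap hq0 hL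
      exact ⟨m, hm.le, hg⟩
  induction h with
  | single h => exact hstep h
  | tail _ h ih =>
    obtain ⟨m, hm, hg⟩ := ih
    obtain ⟨k, hk, hgk⟩ := hstep h
    exact ⟨m + k, add_nonneg hm hk, hg.trans hq0 hgk⟩

/-! ### Interlacing of the entries of a row -/

/-- The two configurations of the last condition in the definition of admissible sets. -/
def Interlaced (C : Set (GTRelation n)) (v w : Vertex n) : Prop :=
  (∃ s t, row s = row v + 1 ∧ row t + 1 = row v ∧
    HasGt C v s ∧ HasGeq C s w ∧ HasGeq C v t ∧ HasGt C t w) ∨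
  (∃ s t, s ≠ t ∧ row s = row v + 1 ∧ row t = row v + 1 ∧
    HasGt C v s ∧ Succeq C s t ∧ HasGeq C t w)

theorem Interlaced.pos (hq0 : q ≠ 0) (hq : ∀ m : ℕ, 0 < m → q ^ m ≠ 1) {v w : Vertex n}
    (h : Interlaced C v w) (hL : ∀ r ∈ C, SatisfiesRel q L r) {m : ℤ} (hm : Gap q (L v - L w) m) :
    0 < m := by
  obtain ⟨s, t, -, -, h₁, h₂, -, -⟩ | ⟨s, t, -, -, -, h₁, h₂, h₃⟩ := h
  · obtain ⟨a, ha, hga⟩ := h₁.gap hq0 hL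
    obtain ⟨b, hb, hgb⟩ := h₂.gap hq0 hL
    rw [hm.unique hq0 hq (hga.trans hq0 hgb)]
    omega
  · obtain ⟨a, ha, hga⟩ := h₁.gap hq0 hL
    obtain ⟨b, hb, hgb⟩ := h₂.gap hq0 hL
    obtain ⟨c, hc, hgc⟩ := h₃.gap hq0 hL
    rw [hm.unique hq0 hq ((hga.trans hq0 hgb).trans hq0 hgc)]
    omega

/-- If interlaced entries differ by one, two entries of the neighbouring rows are determined. -/
theorem Interlaced.squeeze (hq0 : q ≠ 0) (hq : ∀ m : ℕ, 0 < m → q ^ m ≠ 1) {v w : Vertex n}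
    (h : Interlaced C v w) :
    ∃ s t, s ≠ t ∧ row s = row v + 1 ∧
      ((row t + 1 = row v ∧ ∀ L : Tableau n, (∀ r ∈ C, SatisfiesRel q L r) →
          Gap q (L v - L w) 1 → Gap q (L s - L w) 0 ∧ Gap q (L t - L w) 1) ∨
        (row t = row v + 1 ∧ ∀ L : Tableau n, (∀ r ∈ C, SatisfiesRel q L r) →
          Gap q (L v - L w) 1 → Gap q (L s - L w) 0 ∧ Gap q (L t - L w) 0)) := by
  obtain ⟨s, t, hs, ht, h₁, h₂, h₃, h₄⟩ | ⟨s, t, hst, hs, ht, h₁, h₂, h₃⟩ := h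
  · refine ⟨s, t, by rintro rfl; omega, hs, Or.inl ⟨ht, fun L hL hg => ?_⟩⟩
    obtain ⟨a, ha, hga⟩ := h₁.gap hq0 hL
    obtain ⟨b, hb, hgb⟩ := h₂.gap hq0 hL
    obtain ⟨c, hc, hgc⟩ := h₃.gap hq0 hL
    obtain ⟨d, hd, hgd⟩ := h₄.gap hq0 hL
    have e₁ := hg.unique hq0 hq (hga.trans hq0 hgb)
    have e₂ := hg.unique hq0 hq (hgc.trans hq0 hgd)
    obtain rfl : b = 0 := by omega
    obtain rfl : d = 1 := by omega
    exact ⟨hgb, hgd⟩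
  · refine ⟨s, t, hst, hs, Or.inr ⟨ht, fun L hL hg => ?_⟩⟩
    obtain ⟨a, ha, hga⟩ := h₁.gap hq0 hL
    obtain ⟨b, hb, hgb⟩ := h₂.gap hq0 hL
    obtain ⟨c, hc, hgc⟩ := h₃.gap hq0 hL
    have e₁ := hg.unique hq0 hq ((hga.trans hq0 hgb).trans hq0 hgc)
    obtain rfl : b = 0 := by omega
    obtain rfl : c = 0 := by omega
    exact ⟨by simpa using hgb.trans hq0 hgc, hgc⟩

/-- Choose the member `D'` containing one relation of `D`. If `D` were not inside `D'`, then `D ∩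
D'` and `D \ D'` would split `D` into disconnected pieces. -/
theorem exists_component {𝒟 : Set (Set (GTRelation n))} (hdisc : 𝒟.Pairwise Disconnected)
    {D : Set (GTRelation n)} (hD : D ⊆ ⋃₀ 𝒟) (hind : Indecomposable D) {v w : Vertex n}
    (hv : v ∈ verts D) (hw : w ∈ verts D) : ∃ D' ∈ 𝒟, v ∈ verts D' ∧ w ∈ verts D' := by
  obtain ⟨r, hr, hrv⟩ := hv
  obtain ⟨D', hD', hr'⟩ := hD hr
  have hsub : D ⊆ D' := by
    by_contra hnot
    obtain ⟨r', hr'D, hr'D'⟩ := Set.not_subset.1 hnot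
    refine hind ⟨D ∩ D', D \ D', ⟨r, hr, hr'⟩, ⟨r', hr'D, hr'D'⟩,
      (Set.inter_union_sdiff D D').symm, ?_⟩
    refine Set.disjoint_left.2 ?_
    rintro x ⟨r₁, hr₁, hx₁⟩ ⟨r₂, hr₂, hx₂⟩
    obtain ⟨D'', hD'', hr₂'⟩ := hD hr₂.1
    have hne : D' ≠ D'' := by rintro rfl; exact hr₂.2 hr₂'
    exact Set.disjoint_left.1 (hdisc hD' hD'' hne) ⟨r₁, hr₁.2, hx₁⟩ ⟨r₂, hr₂', hx₂⟩
  obtain ⟨r₂, hr₂, hrw⟩ := hw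
  exact ⟨D', hD', ⟨r, hr', hrv⟩, ⟨r₂, hsub hr₂, hrw⟩⟩

/-- The clause `pair` leaves the rows of the auxiliary positions implicit; membership in `ℛ` forces
them, because a relation `≥` that touches a row below `n` is not one between two entries of row `n`.
-/
theorem IndecomposableAdmissible.interlaced {D : Set (GTRelation n)}
    (hD : IndecomposableAdmissible D) (hDC : D ⊆ C) {v w : Vertex n} (hv : v ∈ verts D)
    (hw : w ∈ verts D) (hrow : row v = row w) (hn : row v < n) (hcol : col v < col w) :
    Interlaced C v w := by
  have hgt : ∀ {a b}, HasGt D a b → row a + 1 = row b := by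
    intro a b h
    rcases hD.subset h with (⟨h, -⟩ | ⟨-, h⟩) | ⟨h, -⟩
    · simp at h
    · exact h
    · simp at h
  have hgeq : ∀ {a b}, HasGeq D a b → row a < n ∨ row b < n → row a = row b + 1 := by
    intro a b h hab
    rcases hD.subset h with (⟨-, h⟩ | ⟨h, -⟩) | ⟨-, h₁, h₂, -⟩
    · exact h
    · simp at h
    · simp only at h₁ h₂
      omega
  rcases hD.pair v w hv hw hrow hn hcol with ⟨s, t, ⟨h₁, h₂⟩, h₃, h₄⟩ | ⟨s, t, hst, h₁, h₂, h₃⟩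
  · exact Or.inl ⟨s, t, (hgt h₁).symm, (hgeq h₃ (Or.inl hn)).symm, hDC h₁, hDC h₂, hDC h₃,
      hDC h₄⟩
  · refine Or.inr ⟨s, t, by rintro rfl; exact lt_irrefl _ hst, (hgt h₂).symm, ?_, hDC h₂, ?_,
      hDC h₃⟩
    · rw [hgeq h₃ (Or.inr (hrow ▸ hn)), hrow]
    · exact Relation.TransGen.mono
        (fun a b (h : Step D a b) => Or.imp (fun h => hDC h) (fun h => hDC h) h) _ _ h₁

/-- Every indecomposable part of `C` interlaces its entries, row by row. -/
def Interlacing (C : Set (GTRelation n)) : Prop :=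
  ∀ D ⊆ C, Indecomposable D → ∀ v ∈ verts D, ∀ w ∈ verts D, v ≠ w → row v = row w → row v < n →
    Interlaced C v w ∨ Interlaced C w v

theorem interlacing_sUnion {𝒟 : Set (Set (GTRelation n))}
    (hadm : ∀ D ∈ 𝒟, IndecomposableAdmissible D) (hdisc : 𝒟.Pairwise Disconnected) :
    Interlacing (⋃₀ 𝒟) := by
  intro D hD hind v hv w hw hvw hrow hn
  obtain ⟨D', hD', hv', hw'⟩ := exists_component hdisc hD hind hv hw
  have hsub : D' ⊆ ⋃₀ 𝒟 := Set.subset_sUnion_of_mem hD'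
  rcases lt_trichotomy (col v) (col w) with h | h | h
  · exact Or.inl ((hadm D' hD').interlaced hsub hv' hw' hrow hn h)
  · exact absurd (vertex_ext hrow h) hvw
  · exact Or.inr ((hadm D' hD').interlaced hsub hw' hv' hrow.symm (hrow ▸ hn) h)

theorem Satisfies.interlaced (hq0 : q ≠ 0) (hC : Interlacing C) (hL : Satisfies q C L)
    {v w : Vertex n} (hvw : v ≠ w) (hrow : row v = row w) (hn : row v < n) {m : ℤ}
    (hm : Gap q (L v - L w) m) : Interlaced C v w ∨ Interlaced C w v := by
  obtain ⟨D, hD, hind, hv, hw⟩ := hL.2 v w hvw hrow hn ⟨m, (gap_iff hq0 _ _).1 hm⟩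
  exact hC D hD hind v hv w hw hvw hrow hn

/-- Congruent entries would be interlaced, and either configuration contains a strict relation, so
the gap could not be zero. This gives the nonvanishing of the denominators. -/
theorem Satisfies.not_gap_zero (hq0 : q ≠ 0) (hq : ∀ m : ℕ, 0 < m → q ^ m ≠ 1)
    (hC : Interlacing C) (hL : Satisfies q C L) {v w : Vertex n} (hvw : v ≠ w)
    (hrow : row v = row w) (hn : row v < n) : ¬ Gap q (L v - L w) 0 := by
  intro h
  rcases hL.interlaced hq0 hC hvw hrow hn h with h' | h'
  · exact lt_irrefl _ (h'.pos hq0 hq hL.1 h)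
  · exact lt_irrefl _ (h'.pos hq0 hq hL.1 (m := 0) (by simpa using h.symm))

/-- The sign of the gap selects the direction of interlacing: the opposite one would make `L w - L
v` positive. -/
theorem Satisfies.interlaced_of_gap_one (hq0 : q ≠ 0) (hq : ∀ m : ℕ, 0 < m → q ^ m ≠ 1)
    (hC : Interlacing C) (hL : Satisfies q C L) {v w : Vertex n} (hrow : row v = row w)
    (hn : row v < n) (hm : Gap q (L v - L w) 1) : Interlaced C v w := by
  have hvw : v ≠ w := by
    rintro rfl
    rw [sub_self] at hm
    have := hm.unique hq0 hq (by simpa using gap_intCast (q := q) 0)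
    omega
  refine (hL.interlaced hq0 hC hvw hrow hn hm).resolve_right fun h => ?_
  have := h.pos hq0 hq hL.1 hm.symm
  omega

theorem Satisfies.denom_ne_zero (hq0 : q ≠ 0) (hq : ∀ m : ℕ, 0 < m → q ^ m ≠ 1)
    (hC : Interlacing C) (hL : Satisfies q C L) {v : Vertex n} (hn : row v < n) :
    denom q L v ≠ 0 := by
  refine Finset.prod_ne_zero_iff.2 fun w hw => ?_
  rw [Finset.mem_erase, mem_rowSet] at hw
  rw [Ne, qnum_eq_zero_iff hq0 hq]
  exact hL.not_gap_zero hq0 hq hC hw.1 hw.2 (hw.2 ▸ hn)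

/-! ### Steps between tableaux -/

theorem shift_apply (L : Tableau n) (v : Vertex n) (m : ℤ) (w : Vertex n) :
    shift L v m w = L w + ((if w = v then m else 0 : ℤ) : ℂ) := by
  by_cases h : w = v
  · subst h; simp [shift]
  · simp [shift, h]

theorem shift_apply_self (L : Tableau n) (v : Vertex n) (m : ℤ) : shift L v m v = L v + m := by
  simp [shift_apply]

theorem shift_apply_of_ne (L : Tableau n) {v w : Vertex n} (m : ℤ) (h : w ≠ v) :
    shift L v m w = L w := by
  simp [shift_apply, h]

theorem shift_comm (L : Tableau n) (v w : Vertex n) (m k : ℤ) :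
    shift (shift L v m) w k = shift (shift L w k) v m := by
  simp only [shift, add_right_comm]

theorem shift_shift_neg (L : Tableau n) (v : Vertex n) (m : ℤ) :
    shift (shift L v m) v (-m) = L := by
  ext w
  simp only [shift_apply]
  split_ifs <;> simp

/-- The direction of a step: `e_k` raises an entry and `f_k` lowers one. -/
def stepSign (b : Bool) : ℤ := if b then 1 else -1

/-- The row whose entries occur in the numerator of the coefficient of a step in row `k`. -/
def adjRow (b : Bool) (k : ℕ) : ℕ := if b then k + 1 else k - 1

/-- The coefficient of `T(L ± δ^v)` in `e_k T(L)`, respectively in `f_k T(L)`. -/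
noncomputable def stepCoeff (q : ℂ) (b : Bool) (L : Tableau n) (v : Vertex n) : ℂ :=
  -(stepSign b : ℂ) *
    ((∏ w ∈ rowSet n (adjRow b (row v)), qnum q (L w - L v)) / denom q L v)

theorem stepCoeff_true (L : Tableau n) (v : Vertex n) : stepCoeff q true L v = eCoeff q L v := by
  simp [stepCoeff, stepSign, adjRow, eCoeff]

theorem stepCoeff_false (L : Tableau n) (v : Vertex n) : stepCoeff q false L v = fCoeff q L v := by
  simp [stepCoeff, stepSign, adjRow, fCoeff]

theorem stepCoeff_eq_zero (hq0 : q ≠ 0) (hq : ∀ m : ℕ, 0 < m → q ^ m ≠ 1) {b : Bool}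
    {v w : Vertex n} (hw : row w = adjRow b (row v)) (hg : Gap q (L w - L v) 0) :
    stepCoeff q b L v = 0 := by
  rw [stepCoeff, Finset.prod_eq_zero (mem_rowSet.2 hw) ((qnum_eq_zero_iff hq0 hq _).2 hg), zero_div,
    mul_zero]

theorem gap_shift_iff (hq0 : q ≠ 0) {u v w : Vertex n} {k m : ℤ} :
    Gap q (shift L u k v - shift L u k w) m ↔
      Gap q (L v - L w) (m - ((if v = u then k else 0) - (if w = u then k else 0))) := by
  rw [← gap_add_intCast_iff hq0, shift_apply, shift_apply, Int.cast_sub, add_sub_add_comm]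

/-- Every relation of `C` holds up to an integer. -/
def IntegralOn (q : ℂ) (C : Set (GTRelation n)) (L : Tableau n) : Prop :=
  ∀ r ∈ C, ∃ m : ℤ, Gap q (L r.hi - L r.lo) m

/-- Intermediate tableaux outside the basis may violate relations, but their differences keep an
integer part; a failed strict relation then has integer gap at most zero. -/
theorem IntegralOn.shift (hq0 : q ≠ 0) (hL : IntegralOn q C L) (v : Vertex n) (m : ℤ) :
    IntegralOn q C (shift L v m) := by
  intro r hr
  obtain ⟨k, hk⟩ := hL r hr
  refine ⟨k + ((if r.hi = v then m else 0) - (if r.lo = v then m else 0)), ?_⟩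
  rw [gap_shift_iff hq0]
  simpa using hk

/-- Violating a relation `hi ≥ lo` costs a zero of the coefficient. -/
theorem stepCoeff_eq_zero_of_exit (hq0 : q ≠ 0) (hq : ∀ m : ℕ, 0 < m → q ^ m ≠ 1)
    {r : GTRelation n} (hr : r ∈ allRel n) {b : Bool} {v : Vertex n} (hv : row v < n)
    (hstrict : r.strict = false) (hsat : SatisfiesRel q L r)
    (hnot : ¬ SatisfiesRel q (shift L v (stepSign b)) r) : stepCoeff q b L v = 0 := by
  rw [satisfiesRel_iff hq0] at hsat hnot
  obtain ⟨m, hm, hg⟩ := hsat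
  simp only [hstrict, Bool.false_eq_true, if_false] at hm hnot
  -- A step changes the gap by at most one, so a nonnegative gap can become negative only from `0`.
  -- In the two cases where this happens, the other end of the relation lies in the row read by the
  -- numerator.
  have hlt : m + ((if r.hi = v then stepSign b else 0) - (if r.lo = v then stepSign b else 0)) < 0 := by
    by_contra hge
    refine hnot ⟨_, not_lt.1 hge, ?_⟩
    rw [gap_shift_iff hq0]
    simpa using hg
  rcases hr with (⟨-, hr⟩ | ⟨hr, -⟩) | ⟨-, hr₁, hr₂, -⟩
  · by_cases h₁ : r.hi = v
    · have h₂ : r.lo ≠ v := by rintro rfl; rw [h₁] at hr; omega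
      cases b
      · simp only [h₁, h₂, if_true, if_false, stepSign, Bool.false_eq_true] at hlt
        obtain rfl : m = 0 := by omega
        refine stepCoeff_eq_zero hq0 hq (w := r.lo) ?_ (by simpa [h₁] using hg.symm)
        simp only [adjRow, Bool.false_eq_true, if_false, ← h₁]
        omega
      · simp only [h₁, h₂, if_true, if_false, stepSign] at hlt
        omega
    · by_cases h₂ : r.lo = v
      · cases b
        · simp only [h₁, h₂, if_true, if_false, stepSign, Bool.false_eq_true] at hlt
          omega
        · simp only [h₁, h₂, if_true, if_false, stepSign] at hlt
          obtain rfl : m = 0 := by omega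
          refine stepCoeff_eq_zero hq0 hq (w := r.hi) ?_ (by simpa [h₂] using hg)
          simp only [adjRow, if_true, ← h₂]
          omega
      · simp only [h₁, h₂, if_false] at hlt
        omega
  · simp [hstrict] at hr
  -- Relations inside row `n` cannot break, since steps move only lower rows.
  · have h₁ : r.hi ≠ v := by rintro rfl; omega
    have h₂ : r.lo ≠ v := by rintro rfl; omega
    simp only [h₁, h₂, if_false] at hlt
    omega

/-- Restoring a relation `hi > lo` costs a zero of the coefficient. -/
theorem stepCoeff_eq_zero_of_enter (hq0 : q ≠ 0) (hq : ∀ m : ℕ, 0 < m → q ^ m ≠ 1)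
    {r : GTRelation n} (hr : r ∈ allRel n) {b : Bool} {v : Vertex n}
    (hstrict : r.strict = true) (hInt : ∃ m : ℤ, Gap q (L r.hi - L r.lo) m)
    (hnot : ¬ SatisfiesRel q L r)
    (hsat : SatisfiesRel q (shift L v (stepSign b)) r) : stepCoeff q b L v = 0 := by
  rw [satisfiesRel_iff hq0] at hsat hnot
  obtain ⟨m, hg⟩ := hInt
  obtain ⟨k, hk, hg'⟩ := hsat
  simp only [hstrict, if_true] at hk hnot
  have hle : m ≤ 0 := by
    by_contra hlt
    exact hnot ⟨m, not_le.1 hlt, hg⟩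
  rw [gap_shift_iff hq0] at hg'
  have hmk := hg.unique hq0 hq hg'
  rcases hr with (⟨hr, -⟩ | ⟨-, hr⟩) | ⟨hr, -⟩
  · simp [hstrict] at hr
  · by_cases h₁ : r.hi = v
    · have h₂ : r.lo ≠ v := by rintro rfl; rw [h₁] at hr; omega
      cases b
      · simp only [h₁, h₂, if_true, if_false, stepSign, Bool.false_eq_true] at hmk
        omega
      · simp only [h₁, h₂, if_true, if_false, stepSign] at hmk
        obtain rfl : m = 0 := by omega
        refine stepCoeff_eq_zero hq0 hq (w := r.lo) ?_ (by simpa [h₁] using hg.symm)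
        simp only [adjRow, if_true, ← h₁]
        omega
    · by_cases h₂ : r.lo = v
      · cases b
        · simp only [h₁, h₂, if_true, if_false, stepSign, Bool.false_eq_true] at hmk
          obtain rfl : m = 0 := by omega
          refine stepCoeff_eq_zero hq0 hq (w := r.hi) ?_ (by simpa [h₂] using hg)
          simp only [adjRow, Bool.false_eq_true, if_false, ← h₂]
          omega
        · simp only [h₁, h₂, if_true, if_false, stepSign] at hmk
          omega
      · simp only [h₁, h₂, if_false] at hmk
        omega
  · simp [hstrict] at hr

/-- For a path that leaves and returns, a broken relation `≥` kills the first coefficient and a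
broken relation `>` the second. Only numerators are used, so vanishing denominators at the middle
tableau do no harm. -/
theorem mul_stepCoeff_eq_zero (hq0 : q ≠ 0) (hq : ∀ m : ℕ, 0 < m → q ^ m ≠ 1)
    (hC : C ⊆ allRel n) {b c : Bool} {v w : Vertex n} (hv : row v < n)
    (h₀ : ∀ r ∈ C, SatisfiesRel q L r) (hInt : IntegralOn q C L)
    (h₁ : ¬ ∀ r ∈ C, SatisfiesRel q (shift L v (stepSign b)) r)
    (h₂ : ∀ r ∈ C, SatisfiesRel q (shift (shift L v (stepSign b)) w (stepSign c)) r) :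
    stepCoeff q b L v * stepCoeff q c (shift L v (stepSign b)) w = 0 := by
  push Not at h₁
  obtain ⟨r, hr, hnot⟩ := h₁
  cases hs : r.strict
  · rw [stepCoeff_eq_zero_of_exit hq0 hq (hC hr) hv hs (h₀ r hr) hnot, zero_mul]
  · rw [stepCoeff_eq_zero_of_enter hq0 hq (hC hr) hs (hInt.shift hq0 _ _ r hr) hnot (h₂ r hr),
      mul_zero]

theorem mul_mul_stepCoeff_eq_zero (hq0 : q ≠ 0) (hq : ∀ m : ℕ, 0 < m → q ^ m ≠ 1)
    (hC : C ⊆ allRel n) {b c d : Bool} {u v w : Vertex n} (hu : row u < n) (hv : row v < n)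
    (h₀ : ∀ r ∈ C, SatisfiesRel q L r) (hInt : IntegralOn q C L)
    (h₁ : ¬ ((∀ r ∈ C, SatisfiesRel q (shift L u (stepSign b)) r) ∧
      ∀ r ∈ C, SatisfiesRel q (shift (shift L u (stepSign b)) v (stepSign c)) r))
    (h₂ : ∀ r ∈ C, SatisfiesRel q
      (shift (shift (shift L u (stepSign b)) v (stepSign c)) w (stepSign d)) r) :
    stepCoeff q b L u * stepCoeff q c (shift L u (stepSign b)) v *
      stepCoeff q d (shift (shift L u (stepSign b)) v (stepSign c)) w = 0 := by
  have hInt₁ := hInt.shift hq0 u (stepSign b)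
  have hInt₂ := hInt₁.shift hq0 v (stepSign c)
  -- A single relation that fails at one of the two intermediate tableaux suffices. If it is `≥`,
  -- the step where it first breaks vanishes; if it is `>`, the step that restores it vanishes.
  have key : ∃ r ∈ C, ¬ (SatisfiesRel q (shift L u (stepSign b)) r ∧
      SatisfiesRel q (shift (shift L u (stepSign b)) v (stepSign c)) r) := by
    by_contra! hall
    exact h₁ ⟨fun r hr => (hall r hr).1, fun r hr => (hall r hr).2⟩
  obtain ⟨r, hr, hnot⟩ := key
  cases hs : r.strict
  · by_cases hsat : SatisfiesRel q (shift L u (stepSign b)) r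
    · rw [stepCoeff_eq_zero_of_exit hq0 hq (hC hr) hv hs hsat fun h => hnot ⟨hsat, h⟩]
      simp
    · rw [stepCoeff_eq_zero_of_exit hq0 hq (hC hr) hu hs (h₀ r hr) hsat]
      simp
  · by_cases hsat : SatisfiesRel q (shift (shift L u (stepSign b)) v (stepSign c)) r
    · rw [stepCoeff_eq_zero_of_enter hq0 hq (hC hr) hs (hInt₁ r hr) (fun h => hnot ⟨h, hsat⟩) hsat]
      simp
    · rw [stepCoeff_eq_zero_of_enter hq0 hq (hC hr) hs (hInt₂ r hr) hsat (h₂ r hr)]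
      simp

/-! ### Operators on the space of tableaux -/

/-- `T(R)` is an integral translate of `T(L)` that has the same row `n`, and satisfies the part of
the definition of `ℬ_C(T(L))` that is invariant under integral translations. -/
def InLattice (q : ℂ) (C : Set (GTRelation n)) (L R : Tableau n) : Prop :=
  (∀ v w : Vertex n, v ≠ w → row v = row w → row v < n →
    (∃ m : ℤ, ∃ x ∈ oneSet q, R v - R w = (m : ℂ) + x / 2) →
    ∃ D ⊆ C, Indecomposable D ∧ v ∈ verts D ∧ w ∈ verts D) ∧
  ∃ z : Vertex n → ℤ, (∀ v, row v = n → z v = 0) ∧ R = fun v => L v + (z v : ℂ)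

/-- `InLattice` survives every step below row `n`, so leaving the basis means precisely violating a
relation of `C`. -/
theorem mem_basisSet_iff :
    R ∈ basisSet q C L ↔ (∀ r ∈ C, SatisfiesRel q R r) ∧ InLattice q C L R := by
  simp only [basisSet, InLattice, Satisfies, Set.mem_ofPred_eq, and_assoc]

theorem InLattice.shift (hq0 : q ≠ 0) (h : InLattice q C L R) {v : Vertex n} (hv : row v < n)
    (m : ℤ) : InLattice q C L (shift R v m) := by
  obtain ⟨h₁, z, hz, rfl⟩ := h
  refine ⟨fun a b hab hrow hn hg => h₁ a b hab hrow hn ?_, z + Pi.single v m, ?_, ?_⟩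
  · obtain ⟨k, hk⟩ := hg
    exact ⟨_, (gap_iff hq0 _ _).1 ((gap_shift_iff hq0).1 ((gap_iff hq0 _ _).2 hk))⟩
  · intro w hw
    have hwv : w ≠ v := by rintro rfl; omega
    simp [hz w hw, hwv]
  · ext w
    by_cases hwv : w = v
    · subst hwv; simp [shift_apply, add_assoc]
    · simp [shift_apply, hwv]

theorem integralOn_of_satisfies (hq0 : q ≠ 0) (h : ∀ r ∈ C, SatisfiesRel q R r) :
    IntegralOn q C R := fun r hr => by
  obtain ⟨m, -, hm⟩ := (satisfiesRel_iff hq0 R r).1 (h r hr)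
  exact ⟨m, hm⟩

theorem tabVec_of_mem (hR : R ∈ basisSet q C L) :
    tabVec q C L R = Finsupp.single ⟨R, hR⟩ 1 := by
  rw [tabVec, dif_pos hR]

theorem tabVec_of_notMem (hR : R ∉ basisSet q C L) : tabVec q C L R = 0 := by
  rw [tabVec, dif_neg hR]

theorem gtSpace_hom_ext {f g : Module.End ℂ (GTSpace q C L)}
    (h : ∀ R ∈ basisSet q C L, f (tabVec q C L R) = g (tabVec q C L R)) : f = g := by
  refine Finsupp.lhom_ext' fun R => LinearMap.ext_ring ?_
  have := h R R.2
  rwa [tabVec_of_mem R.2] at this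

/-- The operator that moves the entries of row `k` up (the action of `e_k`) or down (the action of
`f_k`). -/
noncomputable def stepOp (q : ℂ) (C : Set (GTRelation n)) (L : Tableau n) (b : Bool) (k : ℕ) :
    Module.End ℂ (GTSpace q C L) :=
  Finsupp.linearCombination ℂ fun R : basisSet q C L =>
    ∑ v ∈ rowSet n k, stepCoeff q b R v • tabVec q C L (shift R v (stepSign b))

theorem stepOp_tabVec (b : Bool) (k : ℕ) (hR : R ∈ basisSet q C L) :
    stepOp q C L b k (tabVec q C L R) =
      ∑ v ∈ rowSet n k, stepCoeff q b R v • tabVec q C L (shift R v (stepSign b)) := by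
  rw [tabVec_of_mem hR, stepOp, Finsupp.linearCombination_single, one_smul]

/-- The sum includes paths through tableaux outside the basis. Those which end in the basis have
coefficient zero, and the others end in a zero vector. -/
theorem stepOp_stepOp_tabVec (hq0 : q ≠ 0) (hq : ∀ m : ℕ, 0 < m → q ^ m ≠ 1)
    (hC : C ⊆ allRel n) {b c : Bool} {k l : ℕ} (hk : k < n)
    (hR : R ∈ basisSet q C L) :
    stepOp q C L c l (stepOp q C L b k (tabVec q C L R)) =
      ∑ v ∈ rowSet n k, ∑ w ∈ rowSet n l,
        (stepCoeff q b R v * stepCoeff q c (shift R v (stepSign b)) w) •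
          tabVec q C L (shift (shift R v (stepSign b)) w (stepSign c)) := by
  rw [stepOp_tabVec b k hR, map_sum]
  refine Finset.sum_congr rfl fun v hv => ?_
  rw [mem_rowSet] at hv
  rw [map_smul]
  obtain ⟨hsat, hlat⟩ := mem_basisSet_iff.1 hR
  have hlat₁ := hlat.shift hq0 (v := v) (by omega) (stepSign b)
  by_cases hmid : shift R v (stepSign b) ∈ basisSet q C L
  · simp only [stepOp_tabVec c l hmid, Finset.smul_sum, smul_smul]
  · rw [tabVec_of_notMem hmid, map_zero, smul_zero]
    refine (Finset.sum_eq_zero fun w hw => ?_).symm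
    by_cases hend : shift (shift R v (stepSign b)) w (stepSign c) ∈ basisSet q C L
    · rw [mul_stepCoeff_eq_zero hq0 hq hC (by omega) hsat (integralOn_of_satisfies hq0 hsat)
        (fun h => hmid (mem_basisSet_iff.2 ⟨h, hlat₁⟩)) (mem_basisSet_iff.1 hend).1, zero_smul]
    · rw [tabVec_of_notMem hend, smul_zero]

theorem stepOp_stepOp_stepOp_tabVec (hq0 : q ≠ 0) (hq : ∀ m : ℕ, 0 < m → q ^ m ≠ 1)
    (hC : C ⊆ allRel n) {b c d : Bool} {k l j : ℕ} (hk : k < n) (hl : l < n)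
    (hR : R ∈ basisSet q C L) :
    stepOp q C L d j (stepOp q C L c l (stepOp q C L b k (tabVec q C L R))) =
      ∑ u ∈ rowSet n k, ∑ v ∈ rowSet n l, ∑ w ∈ rowSet n j,
        (stepCoeff q b R u * stepCoeff q c (shift R u (stepSign b)) v *
          stepCoeff q d (shift (shift R u (stepSign b)) v (stepSign c)) w) •
          tabVec q C L (shift (shift (shift R u (stepSign b)) v (stepSign c)) w (stepSign d)) := by
  rw [stepOp_tabVec b k hR, map_sum, map_sum]
  refine Finset.sum_congr rfl fun u hu => ?_
  rw [mem_rowSet] at hu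
  rw [map_smul, map_smul]
  obtain ⟨hsat, hlat⟩ := mem_basisSet_iff.1 hR
  have hlat₁ := hlat.shift hq0 (v := u) (by omega) (stepSign b)
  by_cases hmid : shift R u (stepSign b) ∈ basisSet q C L
  · simp only [stepOp_stepOp_tabVec hq0 hq hC hl hmid, Finset.smul_sum, smul_smul, mul_assoc]
  · rw [tabVec_of_notMem hmid, map_zero, map_zero, smul_zero]
    refine (Finset.sum_eq_zero fun v hv => Finset.sum_eq_zero fun w hw => ?_).symm
    rw [mem_rowSet] at hv
    beta_reduce
    by_cases hend : shift (shift (shift R u (stepSign b)) v (stepSign c)) w (stepSign d) ∈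
        basisSet q C L
    · rw [mul_mul_stepCoeff_eq_zero hq0 hq hC (by omega) (by omega) hsat
        (integralOn_of_satisfies hq0 hsat)
        (fun h => hmid (mem_basisSet_iff.2 ⟨h.1, hlat₁⟩)) (mem_basisSet_iff.1 hend).1, zero_smul]
    · rw [tabVec_of_notMem hend, smul_zero]

/-- The diagonal operator by which `q^h` acts. -/
noncomputable def cartanOp (q : ℂ) (C : Set (GTRelation n)) (L : Tableau n) (h : Fin n → ℂ) :
    Module.End ℂ (GTSpace q C L) :=
  Finsupp.linearCombination ℂ fun R : basisSet q C L =>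
    q ^ (∑ k, h k * weight (R : Tableau n) k) • tabVec q C L R

/-- No membership of `R` is needed, as outside the basis both sides vanish; this matters for shifted
tableaux. -/
theorem cartanOp_tabVec (h : Fin n → ℂ) (R : Tableau n) :
    cartanOp q C L h (tabVec q C L R) = q ^ (∑ k, h k * weight R k) • tabVec q C L R := by
  by_cases hR : R ∈ basisSet q C L
  · conv_lhs => rw [tabVec_of_mem hR, cartanOp, Finsupp.linearCombination_single, one_smul]
  · rw [tabVec_of_notMem hR, map_zero, smul_zero]

/-! ### Relations involving the Cartan part -/

theorem sum_rowSet_shift (R : Tableau n) (v : Vertex n) (m : ℤ) (k : ℕ) :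
    ∑ w ∈ rowSet n k, shift R v m w = ∑ w ∈ rowSet n k, R w + if k = row v then (m : ℂ) else 0 := by
  simp only [shift_apply, Finset.sum_add_distrib]
  congr 1
  push_cast
  rw [Finset.sum_ite_eq']
  simp only [mem_rowSet, eq_comm]

theorem sum_weight_shift (h : Fin n → ℂ) (R : Tableau n) (k : Fin (n - 1)) {v : Vertex n}
    (hv : row v = k.1 + 1) (m : ℤ) :
    ∑ j, h j * weight (shift R v m) j = ∑ j, h j * weight R j + m * rootPairing n h k := by
  have hk := k.2
  have h₁ : ∀ j : Fin n, h j * weight (shift R v m) j = h j * weight R j +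
      ((if j = ⟨k.1, by omega⟩ then h j * m else 0) -
        (if j = ⟨k.1 + 1, by omega⟩ then h j * m else 0)) := by
    intro j
    simp only [weight, sum_rowSet_shift, hv, Fin.ext_iff, add_left_inj]
    split_ifs <;> ring
  rw [Finset.sum_congr rfl fun j _ => h₁ j, Finset.sum_add_distrib, Finset.sum_sub_distrib,
    Finset.sum_ite_eq', Finset.sum_ite_eq', rootPairing]
  simp only [Finset.mem_univ, if_true]
  ring

theorem cartanOp_zero : cartanOp q C L 0 = 1 := by
  refine gtSpace_hom_ext fun R _ => ?_
  simp [cartanOp_tabVec]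

theorem cartanOp_mul (hq0 : q ≠ 0) (h h' : Fin n → ℂ) :
    cartanOp q C L h * cartanOp q C L h' = cartanOp q C L (h + h') := by
  refine gtSpace_hom_ext fun R _ => ?_
  rw [Module.End.mul_apply, cartanOp_tabVec, map_smul, cartanOp_tabVec, cartanOp_tabVec, smul_smul,
    ← Complex.cpow_add _ _ hq0, ← Finset.sum_add_distrib]
  congr 2
  exact Finset.sum_congr rfl fun k _ => by rw [Pi.add_apply]; ring

theorem cartanOp_mul_stepOp_mul (hq0 : q ≠ 0) (h : Fin n → ℂ) (b : Bool) (k : Fin (n - 1)) :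
    cartanOp q C L h * stepOp q C L b (k.1 + 1) * cartanOp q C L (-h) =
      q ^ ((stepSign b : ℂ) * rootPairing n h k) • stepOp q C L b (k.1 + 1) := by
  refine gtSpace_hom_ext fun R hR => ?_
  rw [Module.End.mul_apply, Module.End.mul_apply, cartanOp_tabVec, map_smul, map_smul,
    LinearMap.smul_apply, stepOp_tabVec b _ hR, map_sum, Finset.smul_sum, Finset.smul_sum]
  refine Finset.sum_congr rfl fun v hv => ?_
  rw [mem_rowSet] at hv
  rw [map_smul, cartanOp_tabVec, smul_comm (stepCoeff q b R v),
    smul_smul, sum_weight_shift h R k hv, ← Complex.cpow_add _ _ hq0]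
  congr 2
  simp only [Pi.neg_apply, neg_mul, Finset.sum_neg_distrib]
  ring

/-! ### Dependence of the coefficients on single entries -/

theorem prod_qnum_shift (L : Tableau n) {S : Finset (Vertex n)} {x u : Vertex n} (hx : x ∉ S)
    (hu : u ≠ x) (m : ℤ) :
    ∏ w ∈ S, qnum q (shift L x m w - shift L x m u) = ∏ w ∈ S, qnum q (L w - L u) :=
  Finset.prod_congr rfl fun w hw => by
    rw [shift_apply_of_ne L m hu, shift_apply_of_ne L m (ne_of_mem_of_not_mem hw hx)]

theorem stepCoeff_shift_of_row_ne (b : Bool) (L : Tableau n) {x v : Vertex n}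
    (h₁ : row x ≠ row v) (h₂ : row x ≠ adjRow b (row v)) (m : ℤ) :
    stepCoeff q b (shift L x m) v = stepCoeff q b L v := by
  have hv : v ≠ x := fun h => h₁ (h ▸ rfl)
  rw [stepCoeff, stepCoeff, denom, denom, prod_qnum_shift L (by rwa [mem_rowSet]) hv,
    prod_qnum_shift L (by simp [mem_rowSet, h₁]) hv]

/-- The coefficient of a step without the factors that come from the positions in `A`. -/
noncomputable def awayCoeff (q : ℂ) (b : Bool) (L : Tableau n) (v : Vertex n)
    (A : Finset (Vertex n)) : ℂ :=
  -(stepSign b : ℂ) * ((∏ w ∈ rowSet n (adjRow b (row v)) \ A, qnum q (L w - L v)) /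
    ∏ w ∈ (rowSet n (row v)).erase v \ A, qnum q (L w - L v))

theorem awayCoeff_shift (b : Bool) (L : Tableau n) {x v : Vertex n} {A : Finset (Vertex n)}
    (hx : x ∈ A) (hv : v ≠ x) (m : ℤ) :
    awayCoeff q b (shift L x m) v A = awayCoeff q b L v A := by
  rw [awayCoeff, awayCoeff, prod_qnum_shift L (by simp [hx]) hv, prod_qnum_shift L (by simp [hx]) hv]

/-- Isolates the factors contributed by `A`. When only positions of `A` other than `v` move, the
away part is constant and an identity of coefficients reduces to one in a few quantum numbers. -/
theorem stepCoeff_eq_awayCoeff_mul (b : Bool) (L : Tableau n) (v : Vertex n)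
    (A : Finset (Vertex n)) :
    stepCoeff q b L v = awayCoeff q b L v A *
      ((∏ w ∈ A, if row w = adjRow b (row v) then qnum q (L w - L v) else 1) /
        ∏ w ∈ A, if row w = row v ∧ w ≠ v then qnum q (L w - L v) else 1) := by
  have h₁ : rowSet n (adjRow b (row v)) ∩ A = A.filter fun w => row w = adjRow b (row v) := by
    ext w; simp [mem_rowSet, and_comm]
  have h₂ : (rowSet n (row v)).erase v ∩ A = A.filter fun w => row w = row v ∧ w ≠ v := by
    ext w; simp only [Finset.mem_inter, Finset.mem_erase, mem_rowSet, Finset.mem_filter]; tauto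
  rw [stepCoeff, awayCoeff, denom, ← Finset.prod_filter, ← Finset.prod_filter, ← h₁, ← h₂,
    ← Finset.prod_inter_mul_prod_sdiff (rowSet n (adjRow b (row v))) A,
    ← Finset.prod_inter_mul_prod_sdiff ((rowSet n (row v)).erase v) A, mul_div_mul_comm]
  ring

/-! ### Commuting steps -/

theorem stepOp_mul_comm (hq0 : q ≠ 0) (hq : ∀ m : ℕ, 0 < m → q ^ m ≠ 1) (hC : C ⊆ allRel n)
    {b c : Bool} {k l : ℕ} (hk : k < n) (hl : l < n)
    (h : ∀ (R : Tableau n) (v w : Vertex n), row v = k → row w = l →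
      stepCoeff q b R v * stepCoeff q c (shift R v (stepSign b)) w =
        stepCoeff q c R w * stepCoeff q b (shift R w (stepSign c)) v) :
    stepOp q C L b k * stepOp q C L c l = stepOp q C L c l * stepOp q C L b k := by
  refine gtSpace_hom_ext fun R hR => ?_
  rw [Module.End.mul_apply, Module.End.mul_apply, stepOp_stepOp_tabVec hq0 hq hC hl hR,
    stepOp_stepOp_tabVec hq0 hq hC hk hR, Finset.sum_comm]
  refine Finset.sum_congr rfl fun v hv => Finset.sum_congr rfl fun w hw => ?_
  rw [h R v w (mem_rowSet.1 hv) (mem_rowSet.1 hw), shift_comm]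

theorem stepOp_mul_comm_of_far (hq0 : q ≠ 0) (hq : ∀ m : ℕ, 0 < m → q ^ m ≠ 1)
    (hC : C ⊆ allRel n) (b : Bool) {k l : ℕ} (hk : k < n) (hl : l < n)
    (hkl : k + 1 < l ∨ l + 1 < k) :
    stepOp q C L b k * stepOp q C L b l = stepOp q C L b l * stepOp q C L b k := by
  refine stepOp_mul_comm hq0 hq hC hk hl fun R v w hv hw => ?_
  have h : ∀ {i j : ℕ}, (i + 1 < j ∨ j + 1 < i) → i ≠ adjRow b j := by
    intro i j hij
    cases b <;> simp only [adjRow, Bool.false_eq_true, if_true, if_false] <;> omega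
  rw [stepCoeff_shift_of_row_ne b R (by omega) (by rw [hv, hw]; exact h hkl),
    stepCoeff_shift_of_row_ne b R (by omega) (by rw [hv, hw]; exact h hkl.symm), mul_comm]

/-- The two steps influence each other only if `w` is in the row of `v` or in the next one. In both
cases reversing the order changes the sign of two quantum numbers, so the signs cancel; since this
also holds for their inverses, no denominator has to be nonzero. -/
theorem stepCoeff_exchange (R : Tableau n) {v w : Vertex n} (hvw : v ≠ w) :
    stepCoeff q true R v * stepCoeff q false (shift R v (stepSign true)) w =
      stepCoeff q false R w * stepCoeff q true (shift R w (stepSign false)) v := by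
  have hv1 := one_le_row v
  have hw1 := one_le_row w
  by_cases hrow : row w = row v
  · rw [stepCoeff_eq_awayCoeff_mul true R v {w}, stepCoeff_eq_awayCoeff_mul false R w {v},
      stepCoeff_eq_awayCoeff_mul true _ v {w}, stepCoeff_eq_awayCoeff_mul false _ w {v},
      awayCoeff_shift _ _ (by simp) hvw, awayCoeff_shift _ _ (by simp) hvw.symm]
    have h₁ : row v ≠ adjRow false (row w) := by
      simp only [adjRow, Bool.false_eq_true, if_false]; omega
    have h₂ : row w ≠ adjRow true (row v) := by simp only [adjRow, if_true]; omega
    have h₃ : row v = row w ∧ v ≠ w := ⟨hrow.symm, hvw⟩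
    have h₄ : row w = row v ∧ w ≠ v := ⟨hrow, hvw.symm⟩
    simp only [Finset.prod_singleton]
    rw [if_neg h₁, if_neg h₁, if_neg h₂, if_neg h₂, if_pos h₃, if_pos h₃, if_pos h₄, if_pos h₄]
    simp only [shift_apply_self, shift_apply_of_ne _ _ hvw, shift_apply_of_ne _ _ hvw.symm]
    rw [← neg_sub (R w) (R v), qnum_neg,
      show R v + (stepSign true : ℂ) - R w = -(R w + (stepSign false : ℂ) - R v) by
        simp [stepSign]; ring, qnum_neg]
    simp only [div_eq_mul_inv, inv_neg]
    ring
  · by_cases hadj : row w = row v + 1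
    · rw [stepCoeff_eq_awayCoeff_mul true R v {w}, stepCoeff_eq_awayCoeff_mul false R w {v},
        stepCoeff_eq_awayCoeff_mul true _ v {w}, stepCoeff_eq_awayCoeff_mul false _ w {v},
        awayCoeff_shift _ _ (by simp) hvw, awayCoeff_shift _ _ (by simp) hvw.symm]
      have h₁ : row v = adjRow false (row w) := by
        simp only [adjRow, Bool.false_eq_true, if_false]; omega
      have h₂ : row w = adjRow true (row v) := by simp only [adjRow, if_true]; omega
      have h₃ : ¬ (row v = row w ∧ v ≠ w) := fun h => hrow h.1.symm
      have h₄ : ¬ (row w = row v ∧ w ≠ v) := fun h => hrow h.1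
      simp only [Finset.prod_singleton]
      rw [if_pos h₁, if_pos h₁, if_pos h₂, if_pos h₂, if_neg h₃, if_neg h₃, if_neg h₄, if_neg h₄]
      simp only [shift_apply_self, shift_apply_of_ne _ _ hvw, shift_apply_of_ne _ _ hvw.symm]
      rw [← neg_sub (R w) (R v), qnum_neg,
        show R v + (stepSign true : ℂ) - R w = -(R w + (stepSign false : ℂ) - R v) by
          simp [stepSign]; ring, qnum_neg]
      ring
    · rw [stepCoeff_shift_of_row_ne false R (Ne.symm hrow), stepCoeff_shift_of_row_ne true R hrow,
        mul_comm]
      · simpa only [adjRow, if_true] using hadj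
      · simp only [adjRow, Bool.false_eq_true, if_false]; omega

/-! ### Serre relations -/

/-- The core of the Serre relations for two distinct entries of a row, with `x` and `y` their
distances from the third moving entry. The three products correspond to this entry moving first,
second or last. -/
theorem serre_identity (hq0 : q ≠ 0) (b : Bool) (x y : ℂ) :
    (qnum q (x + stepSign b) * qnum q (y + stepSign b) -
        (q + q⁻¹) * (qnum q x * qnum q (y + stepSign b)) + qnum q x * qnum q y) *
          qnum q (x - y + stepSign b) =
      (qnum q (x + stepSign b) * qnum q (y + stepSign b) -
        (q + q⁻¹) * (qnum q y * qnum q (x + stepSign b)) + qnum q y * qnum q x) *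
          qnum q (y - x + stepSign b) := by
  have hx := cpow_ne_zero hq0 x
  have hy := cpow_ne_zero hq0 y
  generalize hc : (q - q⁻¹)⁻¹ = c
  cases b <;>
  · simp only [qnum, stepSign, Bool.false_eq_true, if_true, if_false, Int.cast_neg, Int.cast_one,
      neg_add, neg_sub, neg_neg, Complex.cpow_add _ _ hq0, Complex.cpow_sub _ _ hq0,
      Complex.cpow_neg, Complex.cpow_one, div_eq_mul_inv _ (q - q⁻¹), hc]
    generalize q ^ x = X at *
    generalize q ^ y = Y at *
    field_simp
    ring

theorem serre_identity_same (hq0 : q ≠ 0) (b : Bool) (x : ℂ) :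
    qnum q (x + stepSign b) - (q + q⁻¹) * qnum q x + qnum q (x - stepSign b) = 0 := by
  have hx := cpow_ne_zero hq0 x
  generalize hc : (q - q⁻¹)⁻¹ = c
  cases b <;>
  · simp only [qnum, stepSign, Bool.false_eq_true, if_true, if_false, Int.cast_neg, Int.cast_one,
      neg_add, neg_sub, neg_neg, Complex.cpow_add _ _ hq0, Complex.cpow_sub _ _ hq0,
      Complex.cpow_neg, Complex.cpow_one, div_eq_mul_inv _ (q - q⁻¹), hc]
    generalize q ^ x = X at *
    field_simp
    ring

/-- The coefficient of three successive steps in the same direction. -/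
noncomputable def pathCoeff (q : ℂ) (b : Bool) (R : Tableau n) (u v w : Vertex n) : ℂ :=
  stepCoeff q b R u * stepCoeff q b (shift R u (stepSign b)) v *
    stepCoeff q b (shift (shift R u (stepSign b)) v (stepSign b)) w

/-- The contribution of the positions `u`, `v` of one row and `p` of a neighbouring row, in this
order of `u` and `v`, to the Serre relation. -/
noncomputable def serreCoeff (q : ℂ) (b : Bool) (R : Tableau n) (u v p : Vertex n) : ℂ :=
  pathCoeff q b R p u v - (q + q⁻¹) * pathCoeff q b R u p v + pathCoeff q b R u v p

theorem serre_scalar (hq0 : q ≠ 0) (b : Bool) (x y : ℂ) (h₁ : qnum q (x - y) ≠ 0)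
    (h₂ : qnum q (x - y + stepSign b) ≠ 0) (h₃ : qnum q (y - x + stepSign b) ≠ 0) :
    (qnum q (x + stepSign b) * qnum q (y + stepSign b) -
        (q + q⁻¹) * (qnum q x * qnum q (y + stepSign b)) + qnum q x * qnum q y) /
          (qnum q (x - y) * qnum q (y - x + stepSign b)) +
      (qnum q (y + stepSign b) * qnum q (x + stepSign b) -
        (q + q⁻¹) * (qnum q y * qnum q (x + stepSign b)) + qnum q y * qnum q x) /
          (qnum q (y - x) * qnum q (x - y + stepSign b)) = 0 := by
  have key := serre_identity hq0 b x y
  rw [← neg_sub x y, qnum_neg, neg_sub x y]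
  rw [← neg_sub x y] at key h₃ ⊢
  generalize q + q⁻¹ = t at *
  field_simp
  linear_combination key

/-- Two entries of a row that move together with one entry of another row do not differ by one. -/
theorem Satisfies.not_gap_one (hq0 : q ≠ 0) (hq : ∀ m : ℕ, 0 < m → q ^ m ≠ 1)
    (hC : Interlacing C) (hR : Satisfies q C R) {u v p : Vertex n} (huv : u ≠ v)
    (hrow : row u = row v) (hn : row u < n) (hp : row p ≠ row u) {m : ℤ} (hm : m ≠ 0)
    (hR' : ∀ r ∈ C, SatisfiesRel q (shift (shift (shift R u m) v m) p m) r) :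
    ¬ Gap q (R u - R v) 1 := by
  intro hg
  have hInt := hR.interlaced_of_gap_one hq0 hq hC hrow hn hg
  obtain ⟨s, t, hst, hs, h⟩ := hInt.squeeze hq0 hq
  have hpu : p ≠ u := fun h => hp (h ▸ rfl)
  have hpv : p ≠ v := fun h => hp (h ▸ hrow.symm)
  have hv' : shift (shift (shift R u m) v m) p m v = R v + m := by
    rw [shift_apply_of_ne _ _ hpv.symm, shift_apply_self, shift_apply_of_ne _ _ huv.symm]
  have hu' : shift (shift (shift R u m) v m) p m u = R u + m := by
    rw [shift_apply_of_ne _ _ hpu.symm, shift_apply_of_ne _ _ huv, shift_apply_self]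
  have hg' : Gap q (shift (shift (shift R u m) v m) p m u -
      shift (shift (shift R u m) v m) p m v) 1 := by
    rwa [hu', hv', add_sub_add_right_eq_sub]
  -- The entry at `v` moves by `m ≠ 0`. A position outside this row that keeps its offset from `v`
  -- must move too, so it is `p`; both pinned positions would then equal `p`, although they are
  -- distinct.
  have key : ∀ {x : Vertex n} {k : ℤ}, row x ≠ row u → Gap q (R x - R v) k →
      Gap q (shift (shift (shift R u m) v m) p m x -
        shift (shift (shift R u m) v m) p m v) k → x = p := by
    intro x k hx h₁ h₂
    by_contra hxp
    rw [hv', shift_apply_of_ne _ _ hxp, shift_apply_of_ne _ _ (fun h => hx ((congrArg row h).trans hrow.symm)),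
      shift_apply_of_ne _ _ (fun h => hx (congrArg row h)),
      show R x - (R v + m) = R x - R v + ((-m : ℤ) : ℂ) by push_cast; ring,
      gap_add_intCast_iff hq0] at h₂
    have := h₁.unique hq0 hq h₂
    omega
  rcases h with ⟨ht, h⟩ | ⟨ht, h⟩
  · have h₁ := h R hR.1 hg
    have h₂ := h _ hR' hg'
    exact hst ((key (by omega) h₁.1 h₂.1).trans (key (by omega) h₁.2 h₂.2).symm)
  · have h₁ := h R hR.1 hg
    have h₂ := h _ hR' hg'
    exact hst ((key (by omega) h₁.1 h₂.1).trans (key (by omega) h₁.2 h₂.2).symm)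

theorem adjRow_ne (b : Bool) {k : ℕ} (hk : 1 ≤ k) : k ≠ adjRow b k := by
  cases b <;> simp only [adjRow, Bool.false_eq_true, if_true, if_false] <;> omega

theorem ne_adjRow_adjRow (b : Bool) {k : ℕ} (hk : 1 ≤ k) : k ≠ adjRow b (adjRow b k) := by
  cases b <;> simp only [adjRow, Bool.false_eq_true, if_true, if_false] <;> omega

section SerreCoeff

variable {b : Bool} {u v p : Vertex n}

/-- The Serre relation when the entry at `p` occurs in the coefficients of steps at `u`, `v`. -/
theorem serreCoeff_add_of_adj_left (hq0 : q ≠ 0) (huv : u ≠ v) (hrow : row u = row v)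
    (hp : row p = adjRow b (row u)) (h₁ : qnum q (R v - R u) ≠ 0)
    (h₂ : qnum q (R v - R u + stepSign b) ≠ 0) (h₃ : qnum q (R u - R v + stepSign b) ≠ 0) :
    serreCoeff q b R u v p + serreCoeff q b R v u p = 0 := by
  have hu1 := one_le_row u
  have hpu : row p ≠ row u := hp ▸ (adjRow_ne b hu1).symm
  have hpu' : p ≠ u := fun h => hpu (h ▸ rfl)
  have hpv' : p ≠ v := fun h => hpu (h ▸ hrow.symm)
  have hup : row u ≠ adjRow b (row p) := hp ▸ ne_adjRow_adjRow b hu1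
  have hY₁ : ∀ (S : Tableau n) (m : ℤ), stepCoeff q b (shift S u m) p = stepCoeff q b S p :=
    fun S m => stepCoeff_shift_of_row_ne b S hpu.symm hup m
  have hY₂ : ∀ (S : Tableau n) (m : ℤ), stepCoeff q b (shift S v m) p = stepCoeff q b S p :=
    fun S m => stepCoeff_shift_of_row_ne b S (hrow ▸ hpu.symm) (hrow ▸ hup) m
  have hXu : ∀ S : Tableau n, stepCoeff q b S u =
      awayCoeff q b S u {v, p} * (qnum q (S p - S u) / qnum q (S v - S u)) := fun S => by
    have hv : row v ≠ adjRow b (row u) := hrow ▸ adjRow_ne b hu1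
    rw [stepCoeff_eq_awayCoeff_mul b S u {v, p}, Finset.prod_pair hpv'.symm,
      Finset.prod_pair hpv'.symm, if_pos hp, if_neg hv, if_pos ⟨hrow.symm, huv.symm⟩,
      if_neg (fun h => hpu h.1), one_mul, mul_one]
  have hXv : ∀ S : Tableau n, stepCoeff q b S v =
      awayCoeff q b S v {u, p} * (qnum q (S p - S v) / qnum q (S u - S v)) := fun S => by
    have hv : row u ≠ adjRow b (row v) := hrow ▸ adjRow_ne b hu1
    rw [stepCoeff_eq_awayCoeff_mul b S v {u, p}, Finset.prod_pair hpu'.symm,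
      Finset.prod_pair hpu'.symm, if_pos (hp.trans (by rw [hrow])), if_neg hv, if_pos ⟨hrow, huv⟩,
      if_neg (fun h => hpu (h.1.trans hrow.symm)), one_mul, mul_one]
  have hau : ∀ (S : Tableau n) (m : ℤ), awayCoeff q b (shift S v m) u {v, p} =
      awayCoeff q b S u {v, p} := fun S m => awayCoeff_shift b S (by simp) huv m
  have hau' : ∀ (S : Tableau n) (m : ℤ), awayCoeff q b (shift S p m) u {v, p} =
      awayCoeff q b S u {v, p} := fun S m => awayCoeff_shift b S (by simp) hpu'.symm m
  have hav : ∀ (S : Tableau n) (m : ℤ), awayCoeff q b (shift S u m) v {u, p} =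
      awayCoeff q b S v {u, p} := fun S m => awayCoeff_shift b S (by simp) huv.symm m
  have hav' : ∀ (S : Tableau n) (m : ℤ), awayCoeff q b (shift S p m) v {u, p} =
      awayCoeff q b S v {u, p} := fun S m => awayCoeff_shift b S (by simp) hpv'.symm m
  have key := serre_scalar hq0 b (R p - R u) (R p - R v) (by rwa [sub_sub_sub_cancel_left])
    (by rwa [sub_sub_sub_cancel_left]) (by rwa [sub_sub_sub_cancel_left])
  rw [sub_sub_sub_cancel_left, sub_sub_sub_cancel_left] at key
  simp only [serreCoeff, pathCoeff, hY₁, hY₂, hXu, hXv, hau, hau', hav, hav', shift_apply_self,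
    shift_apply_of_ne _ _ hpu', shift_apply_of_ne _ _ hpu'.symm, shift_apply_of_ne _ _ hpv',
    shift_apply_of_ne _ _ hpv'.symm, shift_apply_of_ne _ _ huv, shift_apply_of_ne _ _ huv.symm,
    add_sub_right_comm]
  linear_combination (stepCoeff q b R p * awayCoeff q b R u {v, p} * awayCoeff q b R v {u, p}) * key

theorem serreCoeff_self_of_adj_left (hq0 : q ≠ 0) (hp : row p = adjRow b (row u)) :
    serreCoeff q b R u u p = 0 := by
  have hu1 := one_le_row u
  have hpu : row p ≠ row u := hp ▸ (adjRow_ne b hu1).symm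
  have hpu' : p ≠ u := fun h => hpu (h ▸ rfl)
  have hup : row u ≠ adjRow b (row p) := hp ▸ ne_adjRow_adjRow b hu1
  have hY : ∀ (S : Tableau n) (m : ℤ), stepCoeff q b (shift S u m) p = stepCoeff q b S p :=
    fun S m => stepCoeff_shift_of_row_ne b S hpu.symm hup m
  have hX : ∀ S : Tableau n, stepCoeff q b S u =
      awayCoeff q b S u {p} * qnum q (S p - S u) := fun S => by
    rw [stepCoeff_eq_awayCoeff_mul b S u {p}, Finset.prod_singleton, Finset.prod_singleton,
      if_pos hp, if_neg (fun h => hpu h.1), div_one]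
  have ha : ∀ (S : Tableau n) (m : ℤ), awayCoeff q b (shift S p m) u {p} =
      awayCoeff q b S u {p} := fun S m => awayCoeff_shift b S (by simp) hpu'.symm m
  have key := serre_identity_same hq0 b (R p - R u)
  simp only [serreCoeff, pathCoeff, hY, shift_comm R p u]
  simp only [hX, ha, shift_apply_self, shift_apply_of_ne _ _ hpu', shift_apply_of_ne _ _ hpu'.symm,
    add_sub_add_right_eq_sub]
  simp only [add_sub_right_comm, ← sub_sub]
  linear_combination (stepCoeff q b R p * awayCoeff q b R u {p} *
    awayCoeff q b (shift R u (stepSign b)) u {p} * qnum q (R p - R u)) * key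

/-- The Serre relation when the entries at `u`, `v` occur in the coefficients of steps at `p`. -/
theorem serreCoeff_add_of_adj_right (hq0 : q ≠ 0) (huv : u ≠ v) (hrow : row u = row v)
    (hp : row u = adjRow b (row p)) (h₁ : qnum q (R v - R u) ≠ 0)
    (h₂ : qnum q (R v - R u + stepSign b) ≠ 0) (h₃ : qnum q (R u - R v + stepSign b) ≠ 0) :
    serreCoeff q b R u v p + serreCoeff q b R v u p = 0 := by
  have hp1 := one_le_row p
  have hpu : row p ≠ row u := hp ▸ adjRow_ne b hp1
  have hpu' : p ≠ u := fun h => hpu (h ▸ rfl)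
  have hpv' : p ≠ v := fun h => hpu (h ▸ hrow.symm)
  have hup : row p ≠ adjRow b (row u) := hp ▸ ne_adjRow_adjRow b hp1
  have hY₁ : ∀ (S : Tableau n) (m : ℤ), stepCoeff q b (shift S p m) u = stepCoeff q b S u :=
    fun S m => stepCoeff_shift_of_row_ne b S hpu hup m
  have hY₂ : ∀ (S : Tableau n) (m : ℤ), stepCoeff q b (shift S p m) v = stepCoeff q b S v :=
    fun S m => stepCoeff_shift_of_row_ne b S (hrow ▸ hpu) (hrow ▸ hup) m
  have hXu : ∀ S : Tableau n, stepCoeff q b S u =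
      awayCoeff q b S u {v} * (1 / qnum q (S v - S u)) := fun S => by
    have hv : row v ≠ adjRow b (row u) := hrow ▸ adjRow_ne b (one_le_row u)
    rw [stepCoeff_eq_awayCoeff_mul b S u {v}, Finset.prod_singleton, Finset.prod_singleton,
      if_neg hv, if_pos ⟨hrow.symm, huv.symm⟩]
  have hXv : ∀ S : Tableau n, stepCoeff q b S v =
      awayCoeff q b S v {u} * (1 / qnum q (S u - S v)) := fun S => by
    have hv : row u ≠ adjRow b (row v) := hrow ▸ adjRow_ne b (one_le_row u)
    rw [stepCoeff_eq_awayCoeff_mul b S v {u}, Finset.prod_singleton, Finset.prod_singleton,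
      if_neg hv, if_pos ⟨hrow, huv⟩]
  have hYp : ∀ S : Tableau n, stepCoeff q b S p =
      awayCoeff q b S p {u, v} * (qnum q (S p - S u) * qnum q (S p - S v)) := fun S => by
    rw [stepCoeff_eq_awayCoeff_mul b S p {u, v}, Finset.prod_pair huv, Finset.prod_pair huv,
      if_pos hp, if_pos (hrow ▸ hp), if_neg (fun h => hpu h.1.symm),
      if_neg (fun h => hpu (h.1.symm.trans hrow.symm)), ← neg_sub (S p) (S u),
      ← neg_sub (S p) (S v), qnum_neg, qnum_neg]
    ring
  have hau : ∀ (S : Tableau n) (m : ℤ), awayCoeff q b (shift S v m) u {v} =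
      awayCoeff q b S u {v} := fun S m => awayCoeff_shift b S (by simp) huv m
  have hav : ∀ (S : Tableau n) (m : ℤ), awayCoeff q b (shift S u m) v {u} =
      awayCoeff q b S v {u} := fun S m => awayCoeff_shift b S (by simp) huv.symm m
  have hap : ∀ (S : Tableau n) (m : ℤ), awayCoeff q b (shift S u m) p {u, v} =
      awayCoeff q b S p {u, v} := fun S m => awayCoeff_shift b S (by simp) hpu' m
  have hap' : ∀ (S : Tableau n) (m : ℤ), awayCoeff q b (shift S v m) p {u, v} =
      awayCoeff q b S p {u, v} := fun S m => awayCoeff_shift b S (by simp) hpv' m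
  -- Here the numerator of the step at `p` drops by one unit in each factor whose entry has already
  -- moved, so the scalar identity is used with both distances reduced by one step.
  have key := serre_scalar hq0 b (R p - R u - stepSign b) (R p - R v - stepSign b)
    (by rwa [sub_sub_sub_cancel_right, sub_sub_sub_cancel_left])
    (by rwa [sub_sub_sub_cancel_right, sub_sub_sub_cancel_left])
    (by rwa [sub_sub_sub_cancel_right, sub_sub_sub_cancel_left])
  simp only [sub_sub_sub_cancel_right, sub_sub_sub_cancel_left, sub_add_cancel] at key
  simp only [serreCoeff, pathCoeff, shift_comm R p u, shift_comm R p v, hY₁, hY₂]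
  simp only [hXu, hXv, hYp, hau, hav, hap, hap', shift_apply_self, shift_apply_of_ne _ _ hpu',
    shift_apply_of_ne _ _ hpv', shift_apply_of_ne _ _ huv, shift_apply_of_ne _ _ huv.symm,
    add_sub_right_comm, ← sub_sub]
  linear_combination
    (awayCoeff q b R p {u, v} * awayCoeff q b R u {v} * awayCoeff q b R v {u}) * key

theorem serreCoeff_self_of_adj_right (hq0 : q ≠ 0) (hp : row u = adjRow b (row p)) :
    serreCoeff q b R u u p = 0 := by
  have hp1 := one_le_row p
  have hpu : row p ≠ row u := hp ▸ adjRow_ne b hp1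
  have hpu' : p ≠ u := fun h => hpu (h ▸ rfl)
  have hup : row p ≠ adjRow b (row u) := hp ▸ ne_adjRow_adjRow b hp1
  have hY : ∀ (S : Tableau n) (m : ℤ), stepCoeff q b (shift S p m) u = stepCoeff q b S u :=
    fun S m => stepCoeff_shift_of_row_ne b S hpu hup m
  have hX : ∀ S : Tableau n, stepCoeff q b S p =
      awayCoeff q b S p {u} * -qnum q (S p - S u) := fun S => by
    rw [stepCoeff_eq_awayCoeff_mul b S p {u}, Finset.prod_singleton, Finset.prod_singleton,
      if_pos hp, if_neg (fun h => hpu h.1.symm), div_one, ← qnum_neg, neg_sub]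
  have ha : ∀ (S : Tableau n) (m : ℤ), awayCoeff q b (shift S u m) p {u} =
      awayCoeff q b S p {u} := fun S m => awayCoeff_shift b S (by simp) hpu' m
  have key := serre_identity_same hq0 b (R p - R u - stepSign b)
  rw [sub_add_cancel] at key
  simp only [serreCoeff, pathCoeff, shift_comm R p u, hY]
  simp only [hX, ha, shift_apply_self, shift_apply_of_ne _ _ hpu', ← sub_sub]
  linear_combination (-stepCoeff q b R u * awayCoeff q b R p {u} *
    stepCoeff q b (shift R u (stepSign b)) u) * key

end SerreCoeff

/-- Assuming that the final tableau satisfies `C` rules out gaps of `±1` between `u` and `v`, which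
are the poles of the rational identity. -/
theorem serreCoeff_add (hq0 : q ≠ 0) (hq : ∀ m : ℕ, 0 < m → q ^ m ≠ 1)
    (hInt : Interlacing C) (hR : Satisfies q C R) {b : Bool} {u v p : Vertex n}
    (hrow : row u = row v) (hn : row u < n) (hp : row u + 1 = row p ∨ row p + 1 = row u)
    (hR' : ∀ r ∈ C, SatisfiesRel q
      (shift (shift (shift R u (stepSign b)) v (stepSign b)) p (stepSign b)) r) :
    serreCoeff q b R u v p + serreCoeff q b R v u p = 0 := by
  have hadj : row p = adjRow b (row u) ∨ row u = adjRow b (row p) := by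
    cases b <;> simp only [adjRow, Bool.false_eq_true, if_true, if_false] <;> omega
  by_cases huv : u = v
  · subst huv
    rcases hadj with hadj | hadj
    · rw [serreCoeff_self_of_adj_left hq0 hadj, add_zero]
    · rw [serreCoeff_self_of_adj_right hq0 hadj, add_zero]
  · have hs : stepSign b ≠ 0 := by cases b <;> simp [stepSign]
    have g₁ := hR.not_gap_one hq0 hq hInt huv hrow hn (by omega) hs hR'
    have g₂ := hR.not_gap_one hq0 hq hInt (Ne.symm huv) hrow.symm (hrow ▸ hn) (p := p) (by omega) hs
      (by rwa [shift_comm R v u])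
    have key : ∀ {x y : ℂ}, ¬ Gap q (x - y) 1 → ¬ Gap q (y - x) 1 →
        qnum q (x - y + stepSign b) ≠ 0 := by
      intro x y h₁ h₂ h
      rw [qnum_eq_zero_iff hq0 hq, gap_add_intCast_iff hq0, zero_sub] at h
      cases b
      · exact h₁ (by simpa [stepSign] using h)
      · exact h₂ (by simpa [stepSign] using h.symm)
    have h₁ : qnum q (R v - R u) ≠ 0 := by
      rw [Ne, qnum_eq_zero_iff hq0 hq]
      exact hR.not_gap_zero hq0 hq hInt (Ne.symm huv) hrow.symm (hrow ▸ hn)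
    rcases hadj with hadj | hadj
    · exact serreCoeff_add_of_adj_left hq0 huv hrow hadj h₁ (key g₂ g₁) (key g₁ g₂)
    · exact serreCoeff_add_of_adj_right hq0 huv hrow hadj h₁ (key g₂ g₁) (key g₁ g₂)

theorem stepOp_serre (hq0 : q ≠ 0) (hq : ∀ m : ℕ, 0 < m → q ^ m ≠ 1) (hC : C ⊆ allRel n)
    (hInt : Interlacing C) (b : Bool) {k l : ℕ} (hk : k < n) (hl : l < n)
    (hkl : k + 1 = l ∨ l + 1 = k) :
    stepOp q C L b k ^ 2 * stepOp q C L b l -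
      (q + q⁻¹) • (stepOp q C L b k * stepOp q C L b l * stepOp q C L b k) +
      stepOp q C L b l * stepOp q C L b k ^ 2 = 0 := by
  refine gtSpace_hom_ext fun R hR => ?_
  set T : Vertex n → Vertex n → Vertex n → GTSpace q C L := fun u v p =>
    tabVec q C L (shift (shift (shift R u (stepSign b)) v (stepSign b)) p (stepSign b)) with hT
  have h₁ : stepOp q C L b k (stepOp q C L b k (stepOp q C L b l (tabVec q C L R))) =
      ∑ u ∈ rowSet n k, ∑ v ∈ rowSet n k, ∑ p ∈ rowSet n l, pathCoeff q b R p u v • T u v p := by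
    rw [stepOp_stepOp_stepOp_tabVec hq0 hq hC hl hk hR, Finset.sum_comm]
    refine Finset.sum_congr rfl fun u _ => ?_
    rw [Finset.sum_comm]
    refine Finset.sum_congr rfl fun v _ => Finset.sum_congr rfl fun p _ => ?_
    rw [pathCoeff, hT, shift_comm R p u, shift_comm _ p v]
  have h₂ : stepOp q C L b k (stepOp q C L b l (stepOp q C L b k (tabVec q C L R))) =
      ∑ u ∈ rowSet n k, ∑ v ∈ rowSet n k, ∑ p ∈ rowSet n l, pathCoeff q b R u p v • T u v p := by
    rw [stepOp_stepOp_stepOp_tabVec hq0 hq hC hk hl hR]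
    refine Finset.sum_congr rfl fun u _ => ?_
    rw [Finset.sum_comm]
    refine Finset.sum_congr rfl fun v _ => Finset.sum_congr rfl fun p _ => ?_
    rw [pathCoeff, hT, shift_comm _ p v]
  have h₃ : stepOp q C L b l (stepOp q C L b k (stepOp q C L b k (tabVec q C L R))) =
      ∑ u ∈ rowSet n k, ∑ v ∈ rowSet n k, ∑ p ∈ rowSet n l, pathCoeff q b R u v p • T u v p :=
    stepOp_stepOp_stepOp_tabVec hq0 hq hC hk hk hR
  have hsum : (stepOp q C L b k ^ 2 * stepOp q C L b l -
      (q + q⁻¹) • (stepOp q C L b k * stepOp q C L b l * stepOp q C L b k) +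
      stepOp q C L b l * stepOp q C L b k ^ 2) (tabVec q C L R) =
      ∑ u ∈ rowSet n k, ∑ v ∈ rowSet n k, ∑ p ∈ rowSet n l, serreCoeff q b R u v p • T u v p := by
    simp only [LinearMap.add_apply, LinearMap.sub_apply, LinearMap.smul_apply, pow_two,
      Module.End.mul_apply, h₁, h₂, h₃, Finset.smul_sum, ← Finset.sum_sub_distrib,
      ← Finset.sum_add_distrib, smul_smul, ← sub_smul, ← add_smul, serreCoeff]
  rw [hsum, LinearMap.zero_apply]
  set W := ∑ u ∈ rowSet n k, ∑ v ∈ rowSet n k, ∑ p ∈ rowSet n l, serreCoeff q b R u v p • T u v p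
    with hW
  -- Cancellation occurs only between `(u, v)` and `(v, u)`; adding the sum to itself with these
  -- interchanged pairs them, and `2` is invertible.
  have hWW : W + W = 0 := by
    conv_lhs => rw [hW]; arg 2; rw [Finset.sum_comm]
    simp only [← Finset.sum_add_distrib]
    refine Finset.sum_eq_zero fun u hu => Finset.sum_eq_zero fun v hv =>
      Finset.sum_eq_zero fun p hp => ?_
    rw [mem_rowSet] at hu hv hp
    have hTs : T v u p = T u v p := by rw [hT]; beta_reduce; rw [shift_comm R v u]
    rw [hTs, ← add_smul]
    by_cases hend : shift (shift (shift R u (stepSign b)) v (stepSign b)) p (stepSign b) ∈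
        basisSet q C L
    · rw [serreCoeff_add hq0 hq hInt hR.1 (hu.trans hv.symm) (hu ▸ hk) (by rw [hu, hp]; exact hkl)
        (mem_basisSet_iff.1 hend).1, zero_smul]
    · rw [hT]; beta_reduce
      rw [tabVec_of_notMem hend, smul_zero]
  rwa [← two_smul ℂ, smul_eq_zero_iff_right two_ne_zero] at hWW

/-! ### The commutator of `e_k` and `f_k` -/

theorem card_rowSet {k : ℕ} (hk : k ≤ n) : (rowSet n k).card = k := by
  rcases Nat.eq_zero_or_pos k with rfl | hpos
  · rw [Finset.card_eq_zero, Finset.eq_empty_iff_forall_notMem]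
    intro v hv
    have := one_le_row v
    rw [mem_rowSet] at hv
    omega
  · obtain ⟨a, rfl⟩ : ∃ a, k = a + 1 := ⟨k - 1, by omega⟩
    have h : rowSet n (a + 1) =
        Finset.univ.map (Function.Embedding.sigmaMk (β := fun a : Fin n => Fin (a.1 + 1)) ⟨a, hk⟩) := by
      ext ⟨⟨i, hi⟩, j⟩
      simp only [mem_rowSet, row, add_left_inj, Finset.mem_map, Finset.mem_univ, true_and,
        Function.Embedding.sigmaMk_apply]
      constructor
      · rintro rfl
        exact ⟨j, rfl⟩
      · rintro ⟨j', hj'⟩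
        exact congrArg (fun v : Vertex n => v.1.1) hj'.symm
    rw [h, Finset.card_map, Finset.card_univ, Fintype.card_fin]

section CommutatorTerms

variable {k : ℕ} {v : Vertex n}

/-- The term at the node `R v` is the coefficient of raising and then lowering `v`. The companion
node `R v - 1` contributes `[-1] = -1`, which matches the sign in the formula for `e_k`. -/
theorem prod_div_prod_erase_inl (hq0 : q ≠ 0) (hq : ∀ m : ℕ, 0 < m → q ^ m ≠ 1) (R : Tableau n)
    (hv : v ∈ rowSet n k) :
    (∏ i ∈ (rowSet n (k + 1)).disjSum (rowSet n (k - 1)),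
        qnum q (Sum.elim R (fun v => R v - 1) i - Sum.elim R (fun v => R v - 1) (Sum.inl v))) /
      ∏ i ∈ ((rowSet n k).disjSum (rowSet n k)).erase (Sum.inl v),
        qnum q (Sum.elim R (fun v => R v - 1) i - Sum.elim R (fun v => R v - 1) (Sum.inl v)) =
      stepCoeff q true R v * stepCoeff q false (shift R v (stepSign true)) v := by
  have herase : ((rowSet n k).disjSum (rowSet n k)).erase (Sum.inl v) =
      ((rowSet n k).erase v).disjSum (rowSet n k) := by
    ext (x | x) <;> simp
  rw [herase, Finset.prod_disjSum, Finset.prod_disjSum]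
  simp only [Sum.elim_inl, Sum.elim_inr]
  rw [← Finset.mul_prod_erase (rowSet n k) (fun w => qnum q (R w - 1 - R v)) hv]
  rw [mem_rowSet] at hv
  have h₁ : ∀ A : Finset (Vertex n), v ∉ A →
      ∏ w ∈ A, qnum q (shift R v (stepSign true) w - shift R v (stepSign true) v) =
        ∏ w ∈ A, qnum q (R w - 1 - R v) := fun A hA => Finset.prod_congr rfl fun w hw => by
    rw [shift_apply_self, shift_apply_of_ne _ _ (ne_of_mem_of_not_mem hw hA)]
    congr 1
    simp only [stepSign, if_true, Int.cast_one]
    ring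
  have hrow := one_le_row v
  rw [stepCoeff, stepCoeff, denom, denom, h₁ _ (Finset.notMem_erase _ _), h₁ _ (by
    rw [mem_rowSet]; exact adjRow_ne false hrow), show R v - 1 - R v = -1 by ring, qnum_neg,
    qnum_one hq0 hq]
  simp only [adjRow, stepSign, hv, if_true, Bool.false_eq_true, if_false, Int.cast_one,
    Int.cast_neg, div_eq_mul_inv, mul_inv, inv_neg, inv_one]
  ring

theorem prod_div_prod_erase_inr (hq0 : q ≠ 0) (hq : ∀ m : ℕ, 0 < m → q ^ m ≠ 1) (R : Tableau n)
    (hv : v ∈ rowSet n k) :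
    (∏ i ∈ (rowSet n (k + 1)).disjSum (rowSet n (k - 1)),
        qnum q (Sum.elim R (fun v => R v - 1) i - Sum.elim R (fun v => R v - 1) (Sum.inr v))) /
      ∏ i ∈ ((rowSet n k).disjSum (rowSet n k)).erase (Sum.inr v),
        qnum q (Sum.elim R (fun v => R v - 1) i - Sum.elim R (fun v => R v - 1) (Sum.inr v)) =
      -(stepCoeff q false R v * stepCoeff q true (shift R v (stepSign false)) v) := by
  have herase : ((rowSet n k).disjSum (rowSet n k)).erase (Sum.inr v) =
      (rowSet n k).disjSum ((rowSet n k).erase v) := by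
    ext (x | x) <;> simp
  rw [herase, Finset.prod_disjSum, Finset.prod_disjSum]
  simp only [Sum.elim_inl, Sum.elim_inr, sub_sub_sub_cancel_right]
  rw [← Finset.mul_prod_erase (rowSet n k) (fun w => qnum q (R w - (R v - 1))) hv]
  rw [mem_rowSet] at hv
  have h₁ : ∀ A : Finset (Vertex n), v ∉ A →
      ∏ w ∈ A, qnum q (shift R v (stepSign false) w - shift R v (stepSign false) v) =
        ∏ w ∈ A, qnum q (R w - (R v - 1)) := fun A hA => Finset.prod_congr rfl fun w hw => by
    rw [shift_apply_self, shift_apply_of_ne _ _ (ne_of_mem_of_not_mem hw hA)]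
    congr 1
    simp only [stepSign, Bool.false_eq_true, if_false, Int.cast_one, Int.cast_neg]
    ring
  have hrow := one_le_row v
  rw [stepCoeff, stepCoeff, denom, denom, h₁ _ (Finset.notMem_erase _ _), h₁ _ (by
    rw [mem_rowSet]; exact adjRow_ne true hrow), sub_sub_cancel, qnum_one hq0 hq]
  simp only [adjRow, stepSign, hv, if_true, Bool.false_eq_true, if_false, Int.cast_one,
    Int.cast_neg, div_eq_mul_inv, mul_inv]
  ring

end CommutatorTerms

/-- Interpolation with `2k` nodes, `R v` and `R v - 1` for `v` in row `k`, and `2k` roots, the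
entries of row `k + 1` and those of row `k - 1` lowered by one. -/
theorem sum_commutator_coeff (hq0 : q ≠ 0) (hq : ∀ m : ℕ, 0 < m → q ^ m ≠ 1)
    (hInt : Interlacing C) (hR : Satisfies q C R) {k : ℕ} (hk0 : 0 < k) (hk : k < n) :
    ∑ v ∈ rowSet n k,
      (stepCoeff q false R v * stepCoeff q true (shift R v (stepSign false)) v -
        stepCoeff q true R v * stepCoeff q false (shift R v (stepSign true)) v) =
      qnum q (∑ v ∈ rowSet n k, R v - ∑ v ∈ rowSet n (k - 1), R v -
        (∑ v ∈ rowSet n (k + 1), R v - ∑ v ∈ rowSet n k, R v) - 1) := by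
  classical
  set S := (rowSet n k).disjSum (rowSet n k) with hS
  set T := (rowSet n (k + 1)).disjSum (rowSet n (k - 1)) with hT
  set z : Vertex n ⊕ Vertex n → ℂ := Sum.elim R fun v => R v - 1 with hz
  have hne : ∀ v ∈ rowSet n k, ∀ w ∈ rowSet n k, v ≠ w → ¬ Gap q (R v - R w) 0 := by
    intro v hv w hw hvw
    rw [mem_rowSet] at hv hw
    exact hR.not_gap_zero hq0 hq hInt hvw (hv.trans hw.symm) (hv ▸ hk)
  have hsub : ∀ x y : ℂ, Gap q (x - 1 - y) 0 ↔ Gap q (x - y) 1 := by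
    intro x y
    rw [show x - 1 - y = x - y + ((-1 : ℤ) : ℂ) by push_cast; ring, gap_add_intCast_iff hq0]
    simp
  have hsymm : ∀ x y : ℂ, Gap q (x - y) 0 → Gap q (y - x) 0 := fun x y h => by simpa using h.symm
  have htrans : ∀ x y w : ℂ, Gap q (x - y) 0 → Gap q (y - w) 0 → Gap q (x - w) 0 :=
    fun x y w h h' => by simpa using h.trans hq0 h'
  -- A collision of nodes means a gap of one, and the pinned entries are then two roots at that
  -- node. A root from row `k - 1` has offset `1`, which its lowering by one turns into `0`.
  have hcross : ∀ v ∈ rowSet n k, ∀ w ∈ rowSet n k, Gap q (R v - 1 - R w) 0 →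
      ∃ s ∈ T, ∃ t ∈ T, s ≠ t ∧ Gap q (Sum.elim R (fun v => R v - 1) s - R w) 0 ∧
        Gap q (Sum.elim R (fun v => R v - 1) t - R w) 0 := by
    intro v hv w hw hg
    rw [mem_rowSet] at hv hw
    rw [hsub] at hg
    have hi := hR.interlaced_of_gap_one hq0 hq hInt (hv.trans hw.symm) (hv ▸ hk) hg
    obtain ⟨s, t, hst, hs, ⟨ht, h⟩ | ⟨ht, h⟩⟩ := hi.squeeze hq0 hq
    · obtain ⟨g₁, g₂⟩ := h R hR.1 hg
      refine ⟨Sum.inl s, ?_, Sum.inr t, ?_, Sum.inl_ne_inr, g₁, (hsub _ _).2 g₂⟩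
      · rw [hT, Finset.inl_mem_disjSum, mem_rowSet, hs, hv]
      · rw [hT, Finset.inr_mem_disjSum, mem_rowSet]; omega
    · obtain ⟨g₁, g₂⟩ := h R hR.1 hg
      refine ⟨Sum.inl s, ?_, Sum.inl t, ?_, fun h => hst (Sum.inl_injective h), g₁, g₂⟩
      · rw [hT, Finset.inl_mem_disjSum, mem_rowSet, hs, hv]
      · rw [hT, Finset.inl_mem_disjSum, mem_rowSet, ht, hv]
  have hnode : ∀ i ∈ S, ∀ j ∈ S, i ≠ j → Gap q (z i - z j) 0 →
      (∃ v ∈ rowSet n k, ∃ w ∈ rowSet n k, i = Sum.inr v ∧ j = Sum.inl w) ∨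
      (∃ v ∈ rowSet n k, ∃ w ∈ rowSet n k, i = Sum.inl w ∧ j = Sum.inr v) := by
    rintro (v | v) hv (w | w) hw hvw hg
    · rw [hS, Finset.inl_mem_disjSum] at hv hw
      exact absurd hg (hne v hv w hw fun h => hvw (h ▸ rfl))
    · rw [hS, Finset.inl_mem_disjSum] at hv
      rw [hS, Finset.inr_mem_disjSum] at hw
      exact Or.inr ⟨w, hw, v, hv, rfl, rfl⟩
    · rw [hS, Finset.inr_mem_disjSum] at hv
      rw [hS, Finset.inl_mem_disjSum] at hw
      exact Or.inl ⟨v, hv, w, hw, rfl, rfl⟩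
    · rw [hS, Finset.inr_mem_disjSum] at hv hw
      refine absurd ?_ (hne v hv w hw fun h => hvw (h ▸ rfl))
      simpa [hz] using hg
  -- Colliding nodes lie on opposite sides of the sum type, so three of them cannot coincide.
  have hside : ∀ i ∈ S, ∀ j ∈ S, i ≠ j → Gap q (z i - z j) 0 → i.isLeft ≠ j.isLeft := by
    intro i hi j hj hij hg
    rcases hnode i hi j hj hij hg with ⟨v, -, w, -, rfl, rfl⟩ | ⟨v, -, w, -, rfl, rfl⟩
    · exact Bool.false_ne_true
    · exact Bool.false_ne_true.symm
  have key := sum_prod_qnum_div hq0 hq S T z (Sum.elim R fun v => R v - 1)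
    (by rw [hS, hT, Finset.card_disjSum, Finset.card_disjSum, card_rowSet hk.le,
          card_rowSet (by omega), card_rowSet (by omega)]; omega)
    (by
      intro i hi j hj l hl hij hil hjl hgij hgil
      have h₁ := hside i hi j hj hij hgij
      have h₂ := hside i hi l hl hil hgil
      have h₃ := hside j hj l hl hjl (htrans _ _ _ (hsymm _ _ hgij) hgil)
      generalize i.isLeft = x at h₁ h₂
      generalize j.isLeft = y at h₁ h₃
      generalize l.isLeft = w at h₂ h₃
      revert x y w
      decide)
    (by
      intro i hi j hj hij hg
      rcases hnode i hi j hj hij hg with ⟨v, hv, w, hw, rfl, rfl⟩ | ⟨v, hv, w, hw, rfl, rfl⟩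
      · obtain ⟨s, hs, t, ht, hst, h₁, h₂⟩ := hcross v hv w hw hg
        exact ⟨s, hs, t, ht, hst, htrans _ _ _ h₁ (hsymm _ _ hg), htrans _ _ _ h₂ (hsymm _ _ hg)⟩
      · exact hcross v hv w hw (hsymm _ _ hg))
  rw [hS, Finset.sum_disjSum, ← hS] at key
  rw [Finset.sum_congr rfl fun v hv => prod_div_prod_erase_inl hq0 hq R hv,
    Finset.sum_congr rfl fun v hv => prod_div_prod_erase_inr hq0 hq R hv, Finset.sum_neg_distrib] at key
  rw [Finset.sum_sub_distrib, ← neg_sub (∑ v ∈ rowSet n k, stepCoeff q true R v * _),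
    sub_eq_add_neg, key, ← qnum_neg, hS, hT, Finset.sum_disjSum, Finset.sum_disjSum]
  simp only [hz, Sum.elim_inl, Sum.elim_inr, Finset.sum_sub_distrib, Finset.sum_const,
    card_rowSet hk.le, card_rowSet (show k - 1 ≤ n by omega), nsmul_eq_mul, mul_one]
  congr 1
  -- The constant `-1` in the statement is `(k - 1) - k`, from the lowered roots and nodes after the
  -- change of sign; it equals the constant part of `a_k - a_{k+1}`.
  push_cast [Nat.cast_sub hk0]
  ring

theorem stepOp_commutator (hq0 : q ≠ 0) (hq : ∀ m : ℕ, 0 < m → q ^ m ≠ 1) (hC : C ⊆ allRel n)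
    (hInt : Interlacing C) (k : Fin (n - 1)) :
    stepOp q C L true (k.1 + 1) * stepOp q C L false (k.1 + 1) -
      stepOp q C L false (k.1 + 1) * stepOp q C L true (k.1 + 1) =
      (q - q⁻¹)⁻¹ • (cartanOp q C L (simpleRoot n k) - cartanOp q C L (-simpleRoot n k)) := by
  have hkn := k.2
  have hk : k.1 + 1 < n := by omega
  refine gtSpace_hom_ext fun R hR => ?_
  rw [LinearMap.sub_apply, Module.End.mul_apply, Module.End.mul_apply,
    stepOp_stepOp_tabVec hq0 hq hC hk hR, stepOp_stepOp_tabVec hq0 hq hC hk hR,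
    Finset.sum_comm, ← Finset.sum_sub_distrib]
  -- After the interchange of sums `v` is always the raised entry and `w` the lowered one. Terms
  -- with `w ≠ v` cancel, and those with `w = v` return to `R`.
  have hinner : ∀ v ∈ rowSet n (k.1 + 1),
      (∑ w ∈ rowSet n (k.1 + 1),
        (stepCoeff q false R w * stepCoeff q true (shift R w (stepSign false)) v) •
          tabVec q C L (shift (shift R w (stepSign false)) v (stepSign true))) -
      (∑ w ∈ rowSet n (k.1 + 1),
        (stepCoeff q true R v * stepCoeff q false (shift R v (stepSign true)) w) •
          tabVec q C L (shift (shift R v (stepSign true)) w (stepSign false))) =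
      (stepCoeff q false R v * stepCoeff q true (shift R v (stepSign false)) v -
        stepCoeff q true R v * stepCoeff q false (shift R v (stepSign true)) v) •
          tabVec q C L R := by
    intro v hv
    rw [← Finset.sum_sub_distrib, Finset.sum_eq_single_of_mem v hv]
    · rw [shift_comm R v v (stepSign false), ← sub_smul,
        show stepSign false = -stepSign true from rfl, shift_shift_neg]
    · intro w _ hwv
      rw [← stepCoeff_exchange R hwv.symm, shift_comm R w v, sub_self]
  rw [Finset.sum_congr rfl hinner, ← Finset.sum_smul,
    sum_commutator_coeff hq0 hq hInt hR.1 (Nat.succ_pos _) hk, LinearMap.smul_apply,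
    LinearMap.sub_apply, cartanOp_tabVec, cartanOp_tabVec, ← sub_smul, smul_smul]
  congr 1
  have hw : ∑ j, simpleRoot n k j * weight R j = weight R ⟨k.1, by omega⟩ - weight R ⟨k.1 + 1, hk⟩ := by
    simp only [simpleRoot, Pi.sub_apply, sub_mul, Finset.sum_sub_distrib, Pi.single_apply, ite_mul,
      one_mul, zero_mul, Finset.sum_ite_eq', Finset.mem_univ, if_true]
  simp only [Pi.neg_apply, neg_mul, Finset.sum_neg_distrib]
  rw [hw, mul_comm, ← div_eq_mul_inv, ← qnum]
  congr 1
  simp only [weight]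
  push_cast
  ring

/-! ### The module structure -/

/-- The operators by which the generators of `U_q(gl_n)` act. -/
noncomputable def genOp (q : ℂ) (C : Set (GTRelation n)) (L : Tableau n) :
    Gen n → Module.End ℂ (GTSpace q C L)
  | Gen.e i => stepOp q C L true (i.1 + 1)
  | Gen.f i => stepOp q C L false (i.1 + 1)
  | Gen.qpow h => cartanOp q C L h

theorem lift_genOp_eq (hq0 : q ≠ 0) (hq : ∀ m : ℕ, 0 < m → q ^ m ≠ 1) (hC : C ⊆ allRel n)
    (hInt : Interlacing C) (L : Tableau n) {x y : FreeAlgebra ℂ (Gen n)} (h : UqRel n q x y) :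
    FreeAlgebra.lift ℂ (genOp q C L) x = FreeAlgebra.lift ℂ (genOp q C L) y := by
  have hlt : ∀ i : Fin (n - 1), i.1 + 1 < n := fun i => by have := i.2; omega
  cases h with
  | qpow_zero => simpa [K, genOp] using cartanOp_zero
  | qpow_add h h' => simpa [K, genOp] using cartanOp_mul hq0 h h'
  | qpow_e h i =>
    simpa [K, E, genOp, stepSign] using cartanOp_mul_stepOp_mul hq0 h true i
  | qpow_f h i =>
    simpa [K, F, genOp, stepSign] using cartanOp_mul_stepOp_mul hq0 h false i
  | e_f_same i =>
    simpa [K, E, F, genOp] using stepOp_commutator hq0 hq hC hInt i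
  | e_f_diff i j hij =>
    have := stepOp_mul_comm (L := L) hq0 hq hC (b := true) (c := false) (hlt i) (hlt j)
      fun R v w hv hw => stepCoeff_exchange R fun h => hij (Fin.ext (by
        have := congrArg row h; omega))
    simpa [E, F, genOp, sub_eq_zero] using this
  | serre_e i j hij =>
    simpa [E, genOp] using stepOp_serre (L := L) hq0 hq hC hInt true (hlt i) (hlt j)
      (hij.imp (by omega) (by omega))
  | serre_f i j hij =>
    simpa [F, genOp] using stepOp_serre (L := L) hq0 hq hC hInt false (hlt i) (hlt j)
      (hij.imp (by omega) (by omega))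
  | comm_e i j hij =>
    simpa [E, genOp] using stepOp_mul_comm_of_far (L := L) hq0 hq hC true (hlt i) (hlt j)
      (hij.imp (by omega) (by omega))
  | comm_f i j hij =>
    simpa [F, genOp] using stepOp_mul_comm_of_far (L := L) hq0 hq hC false (hlt i) (hlt j)
      (hij.imp (by omega) (by omega))

theorem realizable_of_interlacing (hq0 : q ≠ 0) (hq : ∀ m : ℕ, 0 < m → q ^ m ≠ 1)
    (hC : C ⊆ allRel n) (hInt : Interlacing C) : Realizable q C := by
  intro L _
  refine ⟨fun R hR v hv => hR.1.denom_ne_zero hq0 hq hInt hv,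
    RingQuot.liftAlgHom ℂ ⟨FreeAlgebra.lift ℂ (genOp q C L),
      fun _ _ h => lift_genOp_eq hq0 hq hC hInt L h⟩, fun R hR => ?_⟩
  simp only [Uq.gen, RingQuot.liftAlgHom_mkAlgHom_apply, FreeAlgebra.lift_ι_apply, genOp]
  refine ⟨fun h => cartanOp_tabVec h R, fun k => ?_, fun k => ?_⟩
  · rw [stepOp_tabVec true _ hR]
    simp only [stepCoeff_true]
    rfl
  · rw [stepOp_tabVec false _ hR]
    simp only [stepCoeff_false]
    rfl

end QuantumGT

theorem theorem3p9 (n : ℕ) (hn : 2 ≤ n) (q : ℂ) (hq0 : q ≠ 0)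
    (hq : ∀ m : ℕ, 0 < m → q ^ m ≠ 1)
    (C : Set (QuantumGT.GTRelation n)) (𝒟 : Set (Set (QuantumGT.GTRelation n)))
    (hadm : ∀ D ∈ 𝒟, QuantumGT.IndecomposableAdmissible D)
    (hdisc : 𝒟.Pairwise QuantumGT.Disconnected)
    (hC : C = ⋃₀ 𝒟) :
    QuantumGT.Realizable q C := by
  subst hC
  exact QuantumGT.realizable_of_interlacing hq0 hq (Set.sUnion_subset fun D hD => (hadm D hD).subset)
    (QuantumGT.interlacing_sUnion hadm hdisc)
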